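/- Let $S$ be the group generated by $a,b,c,d,e,f,g,h$ subject to $$ab^{-1}=cd^{-1}=ef^{-1}=gh^{-1},\qquad ac^{-1}=bd^{-1}=eg^{-1}=fh^{-1},\qquad ae^{-1}=bf^{-1}=cg^{-1}=dh^{-1},$$ and let $J=\langle x,y,z\rangle$, where $x=ab^{-1}$, $y=ac^{-1}$, $z=ae^{-1}$. Let $X$ be the $3$-dimensional cubing on which $S$ acts: let $x,y,z$ act on $E_3=\mathbb R^3$, cubed by unit cubes, as translations by $2$ units in the three coordinate directions; $X$ is the quotient of $S\times E_3$ ($S$ discrete) by the equivalence relation generated by $(sj,v)\sim(s,j\cdot v)$ for $s\in S$, $j\in J$, $v\in E_3$, and $(sa,v)\sim(s,-v)$ for $s\in S$, $v\in[-1,0]^3$; $S$ acts by left multiplication, and $E_3$ is identified with the image of $\{1\}\times E_3$. (Thus $S\backslash X$ is $J\backslash E_3$ with one antipodal pair of $3$-cells identified.) Let $p,q,r$ be integers with $\gcd(p,q,r)=1$. For real $c$ let $P_c\subset E_3\subset X$ be the plane $px_1+qx_2+rx_3=c$ in unit-cube coordinates $(x_1,x_2,x_3)$ (that is, the plane $x+y+z=c$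 when the edges in the three coordinate directions are given lengths $p,q,r$), and let $P\subset X$ be the union of all $S$-translates of the planes $P_c$ over all $c$ with fractional part $\tfrac12$. Then the connected components of $P$ form a single $S$-orbit, and the component $t$ that contains $P_{1/2}$ is a track: it is a connected subspace that contains no vertex and meets every $2$-cell of $X$ in finitely many parallel straight line segments. There are exactly two connected components $U\neq V$ of $X\setminus P$ whose closures contain $t$, and $S$ splits over the stabilizer $C$ of $t$ as the amalgamated free product $$S=A*_C B,\qquad C\neq A,\quad C\neq B,$$ where $A$ and $B$ are the stabilizers of $U$ and $V$. The group $C$ is isomorphic to the free product of two free abelian groups of rank $2$ and a free group of rank $|p|+|q|+|r|-1$. -/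

import Mathlib

open scoped Pointwise

/-! ### The cube group -/

/-- The eight generators, one for each vertex of a cube. -/
inductive CubeVertex : Type
  | a | b | c | d | e | f | g | h

namespace CubeVertex

/-- The element `u v⁻¹` of the free group on the eight generators. -/
def quo (u v : CubeVertex) : FreeGroup CubeVertex :=
  FreeGroup.of u * (FreeGroup.of v)⁻¹

/-- The relators of `S`; the relation `w = w'` is the relator `w * w'⁻¹`. -/
def relators : Set (FreeGroup CubeVertex) :=
  { quo a b * (quo c d)⁻¹, quo c d * (quo e f)⁻¹, quo e f * (quo g h)⁻¹,
    quo a c * (quo b d)⁻¹, quo b d * (quo e g)⁻¹, quo e g * (quo f h)⁻¹,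
    quo a e * (quo b f)⁻¹, quo b f * (quo c g)⁻¹, quo c g * (quo d h)⁻¹ }

end CubeVertex

/-- The cube group
`S = ⟨a, …, h | ab⁻¹ = cd⁻¹ = ef⁻¹ = gh⁻¹, ac⁻¹ = bd⁻¹ = eg⁻¹ = fh⁻¹, ae⁻¹ = bf⁻¹ = cg⁻¹ = dh⁻¹⟩`. -/
def CubeGroup : Type := PresentedGroup CubeVertex.relators

instance : Group CubeGroup := inferInstanceAs (Group (PresentedGroup CubeVertex.relators))

namespace CubeGroup

/-- The generator of `S` that belongs to a vertex of the cube. -/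
def gen (v : CubeVertex) : CubeGroup := PresentedGroup.of (rels := CubeVertex.relators) v

/-- The elements `x = ab⁻¹`, `y = ac⁻¹`, `z = ae⁻¹`, which generate the free abelian group `J`. -/
def transl : Fin 3 → CubeGroup :=
  ![gen .a * (gen .b)⁻¹, gen .a * (gen .c)⁻¹, gen .a * (gen .e)⁻¹]

end CubeGroup

/-! ### The three-dimensional cubing -/

/-- The gluing relation on the disjoint union of copies of `ℝ³`, one for each element of `S`.
`shift` makes `x`, `y`, `z` act on Euclidean space as translations by `2` units in the coordinate
directions. `flip` makes `a` send the unit cube `[-1,0]³`, with vertices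
`A = (0,0,0)`, `B = (-1,0,0)`, `C = (0,-1,0)`, `D = (-1,-1,0)`, `E = (0,0,-1)`, …, `H = (-1,-1,-1)`,
to the antipodal cube `[0,1]³` by `v ↦ -v`. These are the only identifications. -/
inductive CubingRel : (Σ _ : CubeGroup, Fin 3 → ℝ) → (Σ _ : CubeGroup, Fin 3 → ℝ) → Prop
  | shift (s : CubeGroup) (v : Fin 3 → ℝ) (i : Fin 3) :
      CubingRel ⟨s * CubeGroup.transl i, v⟩ ⟨s, v + Pi.single i 2⟩
  | flip (s : CubeGroup) (v : Fin 3 → ℝ) (hv : ∀ i, v i ∈ Set.Icc (-1 : ℝ) 0) :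
      CubingRel ⟨s * CubeGroup.gen .a, v⟩ ⟨s, -v⟩

/-- The cubing `X`: the quotient of `S × ℝ³` (with `S` discrete) by the equivalence relation
generated by `CubingRel`. It is a union of copies `s E₃` of cubed Euclidean space, indexed by
`S / J`, where `s E₃` and `s a E₃` share a 3-cell; `S \ X` is `J \ E₃` with one antipodal pair
of 3-cells identified. -/
def Cubing : Type := Quot CubingRel

namespace Cubing

instance : TopologicalSpace Cubing := inferInstanceAs (TopologicalSpace (Quot CubingRel))

/-- The point `s • v` of `X`, for `v` in `E₃ = ℝ³`. -/
def mk (s : CubeGroup) (v : Fin 3 → ℝ) : Cubing := Quot.mk CubingRel ⟨s, v⟩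

/-- `S` acts on `X` by `g • mk s v = mk (g * s) v`. -/
instance : MulAction CubeGroup Cubing where
  smul g := Quot.map (fun w => ⟨g * w.1, w.2⟩) (by
    rintro _ _ (⟨s, v, i⟩ | ⟨s, v, hv⟩)
    · simpa only [mul_assoc] using CubingRel.shift (g * s) v i
    · simpa only [mul_assoc] using CubingRel.flip (g * s) v hv)
  one_smul := by
    rintro ⟨s, v⟩
    exact congrArg (fun s' => mk s' v) (one_mul s)
  mul_smul := by
    rintro g g' ⟨s, v⟩
    exact congrArg (fun s' => mk s' v) (mul_assoc g g' s)

/-- The function on `E₃` whose level sets are the leaves: when the cube edges in the three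
coordinate directions are given lengths `p, q, r`, the point with unit-cube coordinates `v` has
length coordinates `(x, y, z) = (p v₀, q v₁, r v₂)`, and this is `x + y + z`. -/
def height (p q r : ℤ) (v : Fin 3 → ℝ) : ℝ := p * v 0 + q * v 1 + r * v 2

/-- The plane `x + y + z = c` in the copy `E₃` of Euclidean space in `X`. -/
def plane (p q r : ℤ) (c : ℝ) : Set Cubing := mk 1 '' {v | height p q r v = c}

/-- The union of all `S`-translates of the planes `x + y + z = c` of `E₃`, where `c` has
fractional part `1/2`. -/
def pattern (p q r : ℤ) : Set Cubing :=
  ⋃ (g : CubeGroup) (c : ℝ) (_ : Int.fract c = 1 / 2), g • plane p q r c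

/-- The point with coordinates `(u, w)` in the 2-cell of the copy `s E₃` that has corner `n` and
directions `i`, `j`. -/
def squarePt (s : CubeGroup) (n : Fin 3 → ℤ) (i j : Fin 3) (u w : ℝ) : Cubing :=
  mk s ((fun k => (n k : ℝ)) + Pi.single i u + Pi.single j w)

/-- A track in `X`: a connected subspace that intersects every 2-cell in finitely many parallel
straight lines (`α u + β w = l`, for `l` in a finite set) and contains no vertex. -/
def IsTrack (t : Set Cubing) : Prop :=
  IsConnected t ∧
  (∀ (s : CubeGroup) (n : Fin 3 → ℤ), mk s (fun k => (n k : ℝ)) ∉ t) ∧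
  ∀ (s : CubeGroup) (n : Fin 3 → ℤ) (i j : Fin 3), i ≠ j →
    ∃ (α β : ℝ) (L : Finset ℝ), (α, β) ≠ (0, 0) ∧
      ∀ u ∈ Set.Icc (0 : ℝ) 1, ∀ w ∈ Set.Icc (0 : ℝ) 1,
        squarePt s n i j u w ∈ t ↔ α * u + β * w ∈ L

end Cubing

/-! ### Components and amalgamated free products -/

/-- `U` is a connected component of the subspace `Y`. -/
def IsComponentOf {X : Type*} [TopologicalSpace X] (Y U : Set X) : Prop :=
  ∃ ξ ∈ Y, U = connectedComponentIn Y ξ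

/-- `G` splits over its subgroup `C` as the amalgamated free product `A *_C B`: `C` is contained
in the subgroups `A` and `B`, is different from both, and the canonical homomorphism
`A *_C B → G` is an isomorphism. -/
def SplitsAsAmalgam {G : Type*} [Group G] (A B C : Subgroup G) : Prop :=
  C ≠ A ∧ C ≠ B ∧ ∃ h : ∀ i : Fin 2, C ≤ ![A, B] i,
    Function.Bijective
      (Monoid.PushoutI.lift (φ := fun i => Subgroup.inclusion (h i))
        (fun i => (![A, B] i).subtype) C.subtype (fun _ => rfl))

/-- The free product of two free abelian groups of rank two and a free group of rank `k`. -/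
abbrev TwoTorusFreeProduct (k : ℕ) : Type :=
  Monoid.Coprod
    (Monoid.Coprod (Multiplicative (ℤ × ℤ)) (Multiplicative (ℤ × ℤ))) (FreeGroup (Fin k))

/-! The relations express every generator through `a` and the commuting elements `x, y, z`, so `S`
is the free product of `J = ℤ³` and the infinite cyclic group on `a` (`exists_lift`,
`closure_translHom_gen_a`). Let `w` be `a` or `a⁻¹`. The copies of `E₃` in `X` are glued along
3-cells by `v ↦ -v`, so height `c` in copy `s` meets height `-c` in copy `s w` exactly for `c` in an
interval `[m, M]` with integer ends, `M - m = |p| + |q| + |r|`.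

In one copy the planes have heights `k + 1/2`, and the slabs between them are centred at integers
`k`. An element `τ` of `J` with `χ τ = 1`, which exists because the gcd is 1, raises heights by 2,
while gluing sends `k + 1/2` to `(-1 - k) + 1/2`, of the other parity. Hence all planes form one
orbit under translations and gluings, whereas slabs keep the parity of their centre. This gives one
class of edges and two classes of vertices.

The stabilizers are written down by generators: the elements of `J` of height 0, together with turns
produced by the gluings that a track or region meets. A membership condition on `(s, k)` compatible
with translation and gluing descends to `X` (`Invariant.mk_mem`). Complementary conditions give
disjoint open sets, and the generators move a connected piece to one that it meets. Together these
identify components and stabilizers without constructing the dual tree.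

Two algebraic facts remain. `exists_amalgam_lift` extends compatible homomorphisms on the two vertex
groups to `S` by freeness. `model_action` lets `S` act on the abstract free product times `ℤ`, which
shows that the generators of the edge group satisfy no further relations. The turn of plane `0` is
trivial, hence the rank `M - m - 1`. -/

namespace CubeGroup

/-! ### The cube group as the free product of `ℤ³` and `ℤ` -/

theorem gen_mul_inv_eq {u v u' v' : CubeVertex}
    (h : CubeVertex.quo u v * (CubeVertex.quo u' v')⁻¹ ∈ CubeVertex.relators) :
    gen u * (gen v)⁻¹ = gen u' * (gen v')⁻¹ :=
  PresentedGroup.mk_eq_mk_of_mul_inv_mem h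

theorem transl_zero : transl 0 = gen .a * (gen .b)⁻¹ := rfl
theorem transl_one : transl 1 = gen .a * (gen .c)⁻¹ := rfl
theorem transl_two : transl 2 = gen .a * (gen .e)⁻¹ := rfl

theorem gen_b : gen .b = (transl 0)⁻¹ * gen .a := by rw [transl_zero]; group
theorem gen_c : gen .c = (transl 1)⁻¹ * gen .a := by rw [transl_one]; group
theorem gen_e : gen .e = (transl 2)⁻¹ * gen .a := by rw [transl_two]; group

theorem gen_eq_of_transl {i : Fin 3} {u v : CubeVertex} (h : transl i = gen u * (gen v)⁻¹) :
    gen v = (transl i)⁻¹ * gen u := by rw [h]; group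

theorem transl_zero_eq_cd : transl 0 = gen .c * (gen .d)⁻¹ :=
  gen_mul_inv_eq (by simp [CubeVertex.relators])
theorem transl_zero_eq_ef : transl 0 = gen .e * (gen .f)⁻¹ :=
  transl_zero_eq_cd.trans (gen_mul_inv_eq (by simp [CubeVertex.relators]))
theorem transl_zero_eq_gh : transl 0 = gen .g * (gen .h)⁻¹ :=
  transl_zero_eq_ef.trans (gen_mul_inv_eq (by simp [CubeVertex.relators]))
theorem transl_one_eq_bd : transl 1 = gen .b * (gen .d)⁻¹ :=
  gen_mul_inv_eq (by simp [CubeVertex.relators])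
theorem transl_one_eq_eg : transl 1 = gen .e * (gen .g)⁻¹ :=
  transl_one_eq_bd.trans (gen_mul_inv_eq (by simp [CubeVertex.relators]))
theorem transl_two_eq_bf : transl 2 = gen .b * (gen .f)⁻¹ :=
  gen_mul_inv_eq (by simp [CubeVertex.relators])
theorem transl_two_eq_cg : transl 2 = gen .c * (gen .g)⁻¹ :=
  transl_two_eq_bf.trans (gen_mul_inv_eq (by simp [CubeVertex.relators]))

/-- On each face of the cube at the vertex `a`, the two routes to the opposite vertex give the same
generator. This forces the two translations to commute. -/
theorem commute_of_square {G : Type*} [Group G] {x y a : G}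
    (h : x⁻¹ * (y⁻¹ * a) = y⁻¹ * (x⁻¹ * a)) : Commute x y := by
  have h' : x⁻¹ * y⁻¹ = y⁻¹ * x⁻¹ := by
    rw [← mul_assoc, ← mul_assoc] at h
    exact mul_right_cancel h
  have h'' : Commute x⁻¹ y⁻¹ := h'
  exact Commute.inv_inv_iff.1 h''

theorem commute_zero_one : Commute (transl 0) (transl 1) :=
  commute_of_square (a := gen .a) (by
    rw [← gen_c, ← gen_b, ← gen_eq_of_transl transl_zero_eq_cd,
      ← gen_eq_of_transl transl_one_eq_bd])

theorem commute_zero_two : Commute (transl 0) (transl 2) :=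
  commute_of_square (a := gen .a) (by
    rw [← gen_e, ← gen_b, ← gen_eq_of_transl transl_zero_eq_ef,
      ← gen_eq_of_transl transl_two_eq_bf])

theorem commute_one_two : Commute (transl 1) (transl 2) :=
  commute_of_square (a := gen .a) (by
    rw [← gen_e, ← gen_c, ← gen_eq_of_transl transl_one_eq_eg, ← gen_eq_of_transl transl_two_eq_cg])

/-- The homomorphism from `ℤ³` given by three commuting elements. -/
def ofCommuting {H : Type*} [Group H] {x y z : H} (hxy : Commute x y) (hxz : Commute x z)
    (hyz : Commute y z) : Multiplicative (Fin 3 → ℤ) →* H :=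
  MonoidHom.mk' (fun n => x ^ (n.toAdd 0) * y ^ (n.toAdd 1) * z ^ (n.toAdd 2)) fun n n' => by
    have h1 := (hxy.zpow_zpow (n'.toAdd 0) (n.toAdd 1)).eq
    have h2 := (hxz.zpow_zpow (n'.toAdd 0) (n.toAdd 2)).eq
    have h3 := (hyz.zpow_zpow (n'.toAdd 1) (n.toAdd 2)).eq
    simp only [toAdd_mul, Pi.add_apply, zpow_add]
    simp only [mul_assoc]
    rw [← mul_assoc (z ^ _) (x ^ _), ← h2, mul_assoc, ← mul_assoc (z ^ _) (y ^ _), ← h3, mul_assoc,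
      ← mul_assoc (y ^ _) (x ^ _), ← h1]
    simp only [mul_assoc]

/-- The inclusion of the group `J` of translations, parametrized by `ℤ³`. -/
def translHom : Multiplicative (Fin 3 → ℤ) →* CubeGroup :=
  ofCommuting commute_zero_one commute_zero_two commute_one_two

theorem translHom_single (i : Fin 3) :
    translHom (Multiplicative.ofAdd (Pi.single i 1)) = transl i := by
  fin_cases i <;> simp [translHom, ofCommuting]

theorem closure_translHom_gen_a :
    Subgroup.closure (Set.range translHom ∪ {gen .a}) = ⊤ := by
  rw [eq_top_iff]
  set K := Subgroup.closure (Set.range translHom ∪ {gen .a})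
  have ha : gen .a ∈ K := Subgroup.subset_closure (by simp)
  have ht (i : Fin 3) : transl i ∈ K :=
    Subgroup.subset_closure (Or.inl ⟨_, translHom_single i⟩)
  have step {i : Fin 3} {u v : CubeVertex} (h : transl i = gen u * (gen v)⁻¹) (hu : gen u ∈ K) :
      gen v ∈ K := by
    rw [gen_eq_of_transl h]
    exact K.mul_mem (K.inv_mem (ht i)) hu
  have hb := step transl_zero ha
  have hc := step transl_one ha
  have he := step transl_two ha
  have hg := step transl_two_eq_cg hc
  rintro x -
  refine PresentedGroup.generated_by _ K (fun v => ?_) x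
  cases v
  exacts [ha, hb, hc, step transl_one_eq_bd hb, he, step transl_two_eq_bf hb, hg,
    step transl_zero_eq_gh hg]

/-- The universal property of `S = ℤ³ * ℤ`. -/
theorem exists_lift {H : Type*} [Group H] (f : Multiplicative (Fin 3 → ℤ) →* H) (b : H) :
    ∃ φ : CubeGroup →* H, φ.comp translHom = f ∧ φ (gen .a) = b := by
  set X := f (.ofAdd (Pi.single 0 1))
  set Y := f (.ofAdd (Pi.single 1 1))
  set Z := f (.ofAdd (Pi.single 2 1))
  have comm (m n : Multiplicative (Fin 3 → ℤ)) : (f m)⁻¹ * (f n)⁻¹ = (f n)⁻¹ * (f m)⁻¹ := by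
    rw [← mul_inv_rev, ← mul_inv_rev, ← map_mul, ← map_mul, mul_comm]
  have hXY : X⁻¹ * Y⁻¹ = Y⁻¹ * X⁻¹ := comm _ _
  have hXZ : X⁻¹ * Z⁻¹ = Z⁻¹ * X⁻¹ := comm _ _
  have hYZ : Y⁻¹ * Z⁻¹ = Z⁻¹ * Y⁻¹ := comm _ _
  -- A vertex of the cube is a subset of the three directions. Commutation makes the value
  -- independent of the route from `a`, and the equations `hd` to `hh'` record the alternative
  -- routes.
  let F : CubeVertex → H
    | .a => b
    | .b => X⁻¹ * b
    | .c => Y⁻¹ * b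
    | .d => X⁻¹ * (Y⁻¹ * b)
    | .e => Z⁻¹ * b
    | .f => X⁻¹ * (Z⁻¹ * b)
    | .g => Y⁻¹ * (Z⁻¹ * b)
    | .h => X⁻¹ * (Y⁻¹ * (Z⁻¹ * b))
  have key : ∀ x y : H, x * (y⁻¹ * x)⁻¹ = y := fun x y => by group
  have hd : F .d = Y⁻¹ * (X⁻¹ * b) := by simp only [F, ← mul_assoc, hXY]
  have hf : F .f = Z⁻¹ * (X⁻¹ * b) := by simp only [F, ← mul_assoc, hXZ]
  have hg : F .g = Z⁻¹ * (Y⁻¹ * b) := by simp only [F, ← mul_assoc, hYZ]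
  have hh : F .h = Y⁻¹ * (X⁻¹ * (Z⁻¹ * b)) := by simp only [F, ← mul_assoc, hXY]
  have hh' : F .h = Z⁻¹ * (X⁻¹ * (Y⁻¹ * b)) := by
    simp only [F]; rw [← mul_assoc Y⁻¹, hYZ]; simp only [← mul_assoc, hXZ]
  have e1 : F .a * (F .b)⁻¹ = X := key _ _
  have e2 : F .c * (F .d)⁻¹ = X := key _ _
  have e3 : F .e * (F .f)⁻¹ = X := key _ _
  have e4 : F .g * (F .h)⁻¹ = X := key _ _
  have e5 : F .a * (F .c)⁻¹ = Y := key _ _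
  have e6 : F .b * (F .d)⁻¹ = Y := by rw [hd]; exact key _ _
  have e7 : F .e * (F .g)⁻¹ = Y := key _ _
  have e8 : F .f * (F .h)⁻¹ = Y := by rw [hh]; exact key _ _
  have e9 : F .a * (F .e)⁻¹ = Z := key _ _
  have e10 : F .b * (F .f)⁻¹ = Z := by rw [hf]; exact key _ _
  have e11 : F .c * (F .g)⁻¹ = Z := by rw [hg]; exact key _ _
  have e12 : F .d * (F .h)⁻¹ = Z := by rw [hh']; exact key _ _
  have hrel : ∀ w ∈ CubeVertex.relators, FreeGroup.lift F w = 1 := by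
    rintro w (h | h | h | h | h | h | h | h | h) <;>
    · rw [h]
      simp only [CubeVertex.quo, map_mul, map_inv, FreeGroup.lift_apply_of, e1, e2, e3, e4, e5, e6,
        e7, e8, e9, e10, e11, e12, mul_inv_cancel]
  let φ : CubeGroup →* H := PresentedGroup.toGroup hrel
  have hφ (v : CubeVertex) : φ (gen v) = F v := PresentedGroup.toGroup.of hrel
  refine ⟨φ, ?_, hφ _⟩
  refine MonoidHom.ext fun n => ?_
  have hn : n = (.ofAdd (Pi.single 0 1)) ^ (n.toAdd 0) * (.ofAdd (Pi.single 1 1)) ^ (n.toAdd 1) *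
      (.ofAdd (Pi.single 2 1)) ^ (n.toAdd 2) := by
    apply Multiplicative.toAdd.injective
    funext i
    fin_cases i <;> simp
  rw [hn]
  simp only [map_mul, map_zpow, MonoidHom.comp_apply, translHom_single]
  rw [transl_zero, transl_one, transl_two]
  simp only [map_mul, map_inv, hφ, e1, e5, e9]
  rfl

end CubeGroup

/-! ### Edge and vertex groups from abstract height data -/

/-- A decomposition of `G` as the free product of the abelian group `J` and the infinite cyclic
group generated by `w`, with a height function `χ` on `J` that maps `τ` to `1`, and an interval
`[m, M]` of heights around `0`. -/
structure HeightData (J G : Type) [CommGroup J] [Group G] where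
  T : J →* G
  w : G
  exists_lift : ∀ {H : Type} [Group H] (f : J →* H) (b : H), ∃ φ : G →* H, φ.comp T = f ∧ φ w = b
  closure_eq : Subgroup.closure (Set.range T ∪ {w}) = ⊤
  χ : J →* Multiplicative ℤ
  τ : J
  χ_τ : χ τ = Multiplicative.ofAdd 1
  m : ℤ
  M : ℤ
  m_nonpos : m ≤ 0
  M_pos : 0 < M

namespace HeightData

variable {J G : Type} [CommGroup J] [Group G] (D : HeightData J G)

/-- The subgroup of `J` of elements of height `0`. -/
abbrev level : Subgroup J := D.χ.ker

/-- The image of `τ` in `G`. -/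
def t : G := D.T D.τ

/-- The elements `t⁻ⁱ w t⁻ⁱ`. -/
def evenTurn (i : ℤ) : G := D.t ^ (-i) * D.w * D.t ^ (-i)

/-- The elements `t⁻ⁱ w t⁻ⁱ⁻¹`. -/
def oddTurn (i : ℤ) : G := D.t ^ (-i) * D.w * D.t ^ (-i - 1)

/-- The generators of the edge group that belong to the interval `[k, k + 1]` of heights. -/
def edgeTurn (k : ℤ) : G :=
  if Even k then D.evenTurn (k / 2) * D.w⁻¹ else D.w * D.evenTurn ((k + 1) / 2)

/-- The element that moves the base edge to the edge `k` of the base copy. -/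
def pos (k : ℤ) : G := if Even k then D.t ^ (k / 2) else D.t ^ ((k + 1) / 2) * D.w⁻¹

theorem exists_eq_two_mul_or (k : ℤ) : ∃ i, k = 2 * i ∨ k = 2 * i - 1 := by
  rcases Int.even_or_odd' k with ⟨i, h | h⟩
  · exact ⟨i, Or.inl h⟩
  · exact ⟨i + 1, Or.inr (by omega)⟩

theorem edgeTurn_even (i : ℤ) : D.edgeTurn (2 * i) = D.evenTurn i * D.w⁻¹ := by
  simp [edgeTurn]

theorem edgeTurn_odd (i : ℤ) : D.edgeTurn (2 * i - 1) = D.w * D.evenTurn i := by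
  simp [edgeTurn]

theorem pos_even (i : ℤ) : D.pos (2 * i) = D.t ^ i := by simp [pos]

theorem pos_odd (i : ℤ) : D.pos (2 * i - 1) = D.t ^ i * D.w⁻¹ := by
  simp [pos]

theorem evenTurn_zero : D.evenTurn 0 = D.w := by simp [evenTurn]

theorem oddTurn_zero : D.oddTurn 0 = D.w * D.t⁻¹ := by simp [oddTurn]

theorem edgeTurn_zero : D.edgeTurn 0 = 1 := by simp [edgeTurn, evenTurn_zero]

/-- The edge group. -/
def edgeGroup : Subgroup G := Subgroup.closure
  (D.T '' D.level ∪ (fun j => D.w * D.T j * D.w⁻¹) '' D.level ∪ D.edgeTurn '' Set.Ico D.m D.M)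

/-- The vertex group of the slabs at even height. -/
def evenGroup : Subgroup G := Subgroup.closure
  (D.T '' D.level ∪ D.evenTurn '' {i | D.m ≤ 2 * i ∧ 2 * i ≤ D.M})

/-- The vertex group of the slabs at odd height. -/
def oddGroup : Subgroup G := Subgroup.closure
  (D.T '' D.level ∪ D.oddTurn '' {i | D.m ≤ 2 * i + 1 ∧ 2 * i + 1 ≤ D.M})

theorem T_mem_edgeGroup {j : J} (hj : j ∈ D.level) : D.T j ∈ D.edgeGroup :=
  Subgroup.subset_closure (Or.inl (Or.inl ⟨j, hj, rfl⟩))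

theorem conj_T_mem_edgeGroup {j : J} (hj : j ∈ D.level) : D.w * D.T j * D.w⁻¹ ∈ D.edgeGroup :=
  Subgroup.subset_closure (Or.inl (Or.inr ⟨j, hj, rfl⟩))

theorem edgeTurn_mem {k : ℤ} (h : D.m ≤ k) (h' : k < D.M) : D.edgeTurn k ∈ D.edgeGroup :=
  Subgroup.subset_closure (Or.inr ⟨k, ⟨h, h'⟩, rfl⟩)

theorem T_mem_evenGroup {j : J} (hj : j ∈ D.level) : D.T j ∈ D.evenGroup :=
  Subgroup.subset_closure (Or.inl ⟨j, hj, rfl⟩)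

theorem evenTurn_mem {i : ℤ} (h : D.m ≤ 2 * i) (h' : 2 * i ≤ D.M) : D.evenTurn i ∈ D.evenGroup :=
  Subgroup.subset_closure (Or.inr ⟨i, ⟨h, h'⟩, rfl⟩)

theorem T_mem_oddGroup {j : J} (hj : j ∈ D.level) : D.T j ∈ D.oddGroup :=
  Subgroup.subset_closure (Or.inl ⟨j, hj, rfl⟩)

theorem oddTurn_mem {i : ℤ} (h : D.m ≤ 2 * i + 1) (h' : 2 * i + 1 ≤ D.M) :
    D.oddTurn i ∈ D.oddGroup :=
  Subgroup.subset_closure (Or.inr ⟨i, ⟨h, h'⟩, rfl⟩)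

theorem w_mem_evenGroup : D.w ∈ D.evenGroup := by
  have := D.m_nonpos
  have := D.M_pos
  simpa [evenTurn_zero] using D.evenTurn_mem (i := 0) (by omega) (by omega)

theorem w_mul_inv_mem_oddGroup : D.w * D.t⁻¹ ∈ D.oddGroup := by
  have := D.m_nonpos
  have := D.M_pos
  simpa [oddTurn_zero] using D.oddTurn_mem (i := 0) (by omega) (by omega)

theorem commute_T_t (j : J) : Commute (D.T j) (D.t) := by
  rw [t, commute_iff_eq, ← map_mul, mul_comm, map_mul]

theorem edgeTurn_even_eq (i : ℤ) :
    D.edgeTurn (2 * i) = D.oddTurn i * (D.w * D.t⁻¹)⁻¹ := by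
  rw [edgeTurn_even, evenTurn, oddTurn]; group

theorem edgeTurn_odd_eq (i : ℤ) :
    D.edgeTurn (2 * i - 1) = D.w * D.t⁻¹ * D.oddTurn (i - 1) := by
  rw [edgeTurn_odd, evenTurn, oddTurn]; group

/-- Since `t` commutes with the image of `J`, the elements `w` and `w t⁻¹` conjugate it in the same
way. So the second factor `D.level` of the edge group also lies in the odd vertex group. -/
theorem conj_T_eq (j : J) :
    D.w * D.T j * D.w⁻¹ = D.w * D.t⁻¹ * D.T j * (D.w * D.t⁻¹)⁻¹ := by
  have h := (D.commute_T_t j).inv_right.eq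
  rw [mul_assoc (D.w) (D.t⁻¹), ← h]; group

theorem edgeGroup_le_evenGroup : D.edgeGroup ≤ D.evenGroup := by
  have hw := D.w_mem_evenGroup
  refine (Subgroup.closure_le _).2 ?_
  rintro x ((⟨j, hj, rfl⟩ | ⟨j, hj, rfl⟩) | ⟨k, ⟨hk, hk'⟩, rfl⟩)
  · exact D.T_mem_evenGroup hj
  · exact mul_mem (mul_mem hw (D.T_mem_evenGroup hj)) (inv_mem hw)
  · obtain ⟨i, rfl | rfl⟩ := exists_eq_two_mul_or k
    · rw [edgeTurn_even]
      exact mul_mem (D.evenTurn_mem (by omega) (by omega)) (inv_mem hw)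
    · rw [edgeTurn_odd]
      exact mul_mem hw (D.evenTurn_mem (by omega) (by omega))

theorem edgeGroup_le_oddGroup : D.edgeGroup ≤ D.oddGroup := by
  have hw := D.w_mul_inv_mem_oddGroup
  refine (Subgroup.closure_le _).2 ?_
  rintro x ((⟨j, hj, rfl⟩ | ⟨j, hj, rfl⟩) | ⟨k, ⟨hk, hk'⟩, rfl⟩)
  · exact D.T_mem_oddGroup hj
  · simp only [D.conj_T_eq]
    exact mul_mem (mul_mem hw (D.T_mem_oddGroup hj)) (inv_mem hw)
  · obtain ⟨i, rfl | rfl⟩ := exists_eq_two_mul_or k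
    · rw [edgeTurn_even_eq]
      exact mul_mem (D.oddTurn_mem (by omega) (by omega)) (inv_mem hw)
    · rw [edgeTurn_odd_eq]
      exact mul_mem hw (D.oddTurn_mem (by omega) (by omega))

/-- The projection of `J` to the elements of height `0` along `τ`. -/
def levelPart : J →* D.level :=
  MonoidHom.mk' (fun n => ⟨n * D.τ ^ (-(D.χ n).toAdd), by
      rw [MonoidHom.mem_ker, map_mul, map_zpow, D.χ_τ, ← ofAdd_zsmul]
      apply Multiplicative.toAdd.injective
      simp⟩) fun n n' => by
    ext
    simp only [map_mul, toAdd_mul, neg_add, zpow_add, Subgroup.coe_mul]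
    rw [mul_mul_mul_comm]

theorem levelPart_mul (n : J) : (D.levelPart n : J) * D.τ ^ (D.χ n).toAdd = n := by
  simp [levelPart]

theorem T_eq (n : J) : D.T n = D.T (D.levelPart n) * D.t ^ (D.χ n).toAdd := by
  conv_lhs => rw [← D.levelPart_mul n]
  rw [map_mul, map_zpow, t]

theorem levelPart_coe (l : D.level) : D.levelPart l = l := by
  ext
  have : D.χ l = 1 := l.2
  simp [levelPart, this]

theorem levelPart_τ : D.levelPart D.τ = 1 := by
  ext
  simp [levelPart, D.χ_τ]

/-- Extend a homomorphism from the elements of height `0` to `J`, with a given image of `τ`. -/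
def extend {H : Type} [Group H] (f : D.level →* H) (g : H) (hc : ∀ l, Commute (f l) g) : J →* H :=
  MonoidHom.mk' (fun n => f (D.levelPart n) * g ^ (D.χ n).toAdd) fun n n' => by
    have := ((hc (D.levelPart n')).zpow_right (D.χ n).toAdd).eq
    simp only [map_mul, toAdd_mul, zpow_add]
    rw [mul_assoc, ← mul_assoc (f (D.levelPart n')), this]
    simp only [mul_assoc]

theorem extend_coe {H : Type} [Group H] (f : D.level →* H) (g : H) (hc : ∀ l, Commute (f l) g)
    (l : D.level) : D.extend f g hc l = f l := by
  have : D.χ l = 1 := l.2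
  simp [extend, levelPart_coe, this]

theorem extend_τ {H : Type} [Group H] (f : D.level →* H) (g : H) (hc : ∀ l, Commute (f l) g) :
    D.extend f g hc D.τ = g := by
  simp [extend, levelPart_τ, D.χ_τ]

/-! ### Labels -/

/-- Split `n` into a part of height 0 and a power of `τ`. The power shifts heights by even integers.
The rest is absorbed by the edge group, directly for even `k` and after conjugation by `w` for odd
`k`. -/
theorem edge_translate (s : G) (n : J) (k : ℤ) :
    s * D.T n * D.pos k ∈ D.edgeGroup ↔ s * D.pos (k + 2 * (D.χ n).toAdd) ∈ D.edgeGroup := by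
  have hl : (D.levelPart n : J) ∈ D.level := (D.levelPart n).2
  rw [T_eq]
  set c := (D.χ n).toAdd
  obtain ⟨i, rfl | rfl⟩ := exists_eq_two_mul_or k
  · rw [← mul_add, pos_even, pos_even, ← Subgroup.mul_mem_cancel_right _ (D.T_mem_edgeGroup hl)
      (y := s * D.t ^ (i + c)), mul_assoc s (D.t ^ _) (D.T _),
      ← ((D.commute_T_t (D.levelPart n)).zpow_right (i + c)).eq, add_comm i c, zpow_add]
    simp only [mul_assoc]
  · rw [show 2 * i - 1 + 2 * c = 2 * (i + c) - 1 by ring, pos_odd, pos_odd,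
      ← Subgroup.mul_mem_cancel_right _ (D.conj_T_mem_edgeGroup hl)
      (y := s * (D.t ^ (i + c) * D.w⁻¹))]
    have : s * (D.t ^ (i + c) * D.w⁻¹) * (D.w * D.T (D.levelPart n) * D.w⁻¹) =
        s * (D.t ^ (i + c) * D.T (D.levelPart n)) * D.w⁻¹ := by group
    rw [this, ← ((D.commute_T_t (D.levelPart n)).zpow_right (i + c)).eq, add_comm i c, zpow_add]
    simp only [mul_assoc]

/-- The index `-1 - k` appears because `-(k + 1/2) = (-1 - k) + 1/2`. The two representatives differ
by `edgeTurn k`, which is a generator exactly when the plane `k` meets the glued cube. -/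
theorem edge_turn (s : G) {k : ℤ} (h : D.m ≤ k) (h' : k < D.M) :
    s * D.w * D.pos (-1 - k) ∈ D.edgeGroup ↔ s * D.pos k ∈ D.edgeGroup := by
  rw [← Subgroup.mul_mem_cancel_right _ (D.edgeTurn_mem h h') (y := s * D.pos k)]
  obtain ⟨i, rfl | rfl⟩ := exists_eq_two_mul_or k
  · rw [show -1 - 2 * i = 2 * (-i) - 1 by ring, pos_odd, pos_even, edgeTurn_even, evenTurn]
    congr! 1
    group
  · rw [show -1 - (2 * i - 1) = 2 * (-i) by ring, pos_odd, pos_even, edgeTurn_odd, evenTurn]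
    congr! 1
    group

theorem translate_mem_iff (H : Subgroup G) (hH : ∀ j ∈ D.level, D.T j ∈ H) (s : G) (n : J)
    (i : ℤ) : s * D.T n * D.t ^ i ∈ H ↔ s * D.t ^ (i + (D.χ n).toAdd) ∈ H := by
  have hl : (D.levelPart n : J) ∈ D.level := (D.levelPart n).2
  rw [T_eq]
  set c := (D.χ n).toAdd
  rw [← Subgroup.mul_mem_cancel_right _ (hH _ hl) (y := s * D.t ^ (i + c)),
      mul_assoc s (D.t ^ _) (D.T _),
      ← ((D.commute_T_t (D.levelPart n)).zpow_right (i + c)).eq, add_comm i c, zpow_add]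
  simp only [mul_assoc]

theorem even_turn (s : G) {i : ℤ} (h : D.m ≤ 2 * i) (h' : 2 * i ≤ D.M) :
    s * D.w * D.t ^ (-i) ∈ D.evenGroup ↔ s * D.t ^ i ∈ D.evenGroup := by
  rw [← Subgroup.mul_mem_cancel_right _ (D.evenTurn_mem h h') (y := s * D.t ^ i), evenTurn]
  congr! 1
  group

theorem odd_turn (s : G) {i : ℤ} (h : D.m ≤ 2 * i + 1) (h' : 2 * i + 1 ≤ D.M) :
    s * D.w * D.t ^ (-i - 1) ∈ D.oddGroup ↔ s * D.t ^ i ∈ D.oddGroup := by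
  rw [← Subgroup.mul_mem_cancel_right _ (D.oddTurn_mem h h') (y := s * D.t ^ i), oddTurn]
  congr! 1
  group

/-- The planes `2 * i - 1` and `2 * i` bound the slab centred at height `2 * i`, so a track through
either of them is adjacent to that slab's region. -/
theorem pos_mem_even {s : G} {i : ℤ} (h : s * D.pos (2 * i) ∈ D.edgeGroup ∨
    s * D.pos (2 * i - 1) ∈ D.edgeGroup) : s * D.t ^ i ∈ D.evenGroup := by
  rw [pos_even, pos_odd] at h
  rcases h with h | h
  · exact D.edgeGroup_le_evenGroup h
  · have := mul_mem (D.edgeGroup_le_evenGroup h) D.w_mem_evenGroup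
    simpa [mul_assoc] using this

theorem pos_mem_odd {s : G} {i : ℤ} (h : s * D.pos (2 * i) ∈ D.edgeGroup ∨
    s * D.pos (2 * i + 1) ∈ D.edgeGroup) : s * D.t ^ i ∈ D.oddGroup := by
  rw [show 2 * i + 1 = 2 * (i + 1) - 1 by ring, pos_even, pos_odd] at h
  rcases h with h | h
  · exact D.edgeGroup_le_oddGroup h
  · have := mul_mem (D.edgeGroup_le_oddGroup h) D.w_mul_inv_mem_oddGroup
    simpa [mul_assoc, zpow_add] using this

end HeightData

/-- Applying the lifting property to the pushout itself yields a left inverse of the canonical map.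
Only existence of lifts is needed, as surjectivity comes from the generation hypothesis. -/
theorem SplitsAsAmalgam.of_exists_lift {G : Type} [Group G] {A B C : Subgroup G} (hCA : C ≤ A)
    (hCB : C ≤ B) (hA : C ≠ A) (hB : C ≠ B)
    (hlift : ∀ {P : Type} [Group P] (f : A →* P) (g : B →* P),
      (∀ x (hx : x ∈ C), f ⟨x, hCA hx⟩ = g ⟨x, hCB hx⟩) →
      ∃ θ : G →* P, (∀ x : A, θ x = f x) ∧ ∀ x : B, θ x = g x)
    (htop : A ⊔ B = ⊤) : SplitsAsAmalgam A B C := by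
  have h : ∀ i : Fin 2, C ≤ ![A, B] i := by
    intro i
    fin_cases i
    exacts [hCA, hCB]
  refine ⟨hA, hB, h, ?_⟩
  let φ := fun i : Fin 2 => Subgroup.inclusion (h i)
  let Λ : Monoid.PushoutI φ →* G := Monoid.PushoutI.lift (φ := φ)
    (fun i => (![A, B] i).subtype) C.subtype (fun _ => rfl)
  let f : A →* Monoid.PushoutI φ := Monoid.PushoutI.of (φ := φ) 0
  let g : B →* Monoid.PushoutI φ := Monoid.PushoutI.of (φ := φ) 1
  have hΛf (x : A) : Λ (f x) = x := Monoid.PushoutI.lift_of (φ := φ) _ _ _ (i := 0) x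
  have hΛg (x : B) : Λ (g x) = x := Monoid.PushoutI.lift_of (φ := φ) _ _ _ (i := 1) x
  obtain ⟨θ, hθf, hθg⟩ := hlift f g fun x hx =>
    (Monoid.PushoutI.of_apply_eq_base φ 0 ⟨x, hx⟩).trans
      (Monoid.PushoutI.of_apply_eq_base φ 1 ⟨x, hx⟩).symm
  have hleft : θ.comp Λ = MonoidHom.id _ := by
    refine Monoid.PushoutI.hom_ext_nonempty fun i => MonoidHom.ext fun x => ?_
    fin_cases i
    · exact (congrArg θ (hΛf x)).trans (hθf x)
    · exact (congrArg θ (hΛg x)).trans (hθg x)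
  refine ⟨Function.LeftInverse.injective (DFunLike.congr_fun hleft), ?_⟩
  change Function.Surjective Λ
  rw [← MonoidHom.range_eq_top, eq_top_iff, ← htop, sup_le_iff]
  exact ⟨fun x hx => ⟨f ⟨x, hx⟩, hΛf _⟩, fun x hx => ⟨g ⟨x, hx⟩, hΛg _⟩⟩

namespace HeightData

variable {J G : Type} [CommGroup J] [Group G] (D : HeightData J G)

/-! ### The amalgamated product -/

/-- The parity of the exponent of `w` separates the edge group from both vertex groups: it vanishes
on the edge generators but not on `w` or `w t⁻¹`. -/
theorem exists_parity : ∃ φ : G →* Multiplicative (ZMod 2),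
    (∀ n, φ (D.T n) = 1) ∧ φ D.w = Multiplicative.ofAdd 1 := by
  obtain ⟨φ, h, h'⟩ := D.exists_lift (1 : J →* Multiplicative (ZMod 2)) (Multiplicative.ofAdd 1)
  exact ⟨φ, fun n => DFunLike.congr_fun h n, h'⟩

theorem edgeGroup_le_ker {φ : G →* Multiplicative (ZMod 2)} (h : ∀ n, φ (D.T n) = 1)
    (hw : φ D.w = Multiplicative.ofAdd 1) : D.edgeGroup ≤ φ.ker := by
  have ht (i : ℤ) : φ (D.t ^ i) = 1 := by rw [map_zpow, t, h, one_zpow]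
  refine (Subgroup.closure_le _).2 ?_
  rintro x ((⟨j, hj, rfl⟩ | ⟨j, hj, rfl⟩) | ⟨k, ⟨hk, hk'⟩, rfl⟩)
  · exact h j
  · simp [h]
  · obtain ⟨i, rfl | rfl⟩ := exists_eq_two_mul_or k
    · simp only [SetLike.mem_coe, MonoidHom.mem_ker, edgeTurn_even, evenTurn, map_mul, map_inv, ht,
        hw]
      decide
    · simp only [SetLike.mem_coe, MonoidHom.mem_ker, edgeTurn_odd, evenTurn, map_mul, ht, hw]
      decide

theorem edgeGroup_ne_evenGroup : D.edgeGroup ≠ D.evenGroup := fun h => by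
  obtain ⟨φ, hφ, hw⟩ := D.exists_parity
  have := D.edgeGroup_le_ker hφ hw (h ▸ D.w_mem_evenGroup)
  rw [MonoidHom.mem_ker, hw] at this
  exact absurd this (by decide)

theorem edgeGroup_ne_oddGroup : D.edgeGroup ≠ D.oddGroup := fun h => by
  obtain ⟨φ, hφ, hw⟩ := D.exists_parity
  have := D.edgeGroup_le_ker hφ hw (h ▸ D.w_mul_inv_mem_oddGroup)
  rw [MonoidHom.mem_ker, map_mul, map_inv, hw, t, hφ] at this
  exact absurd this (by decide)

theorem evenGroup_sup_oddGroup : D.evenGroup ⊔ D.oddGroup = ⊤ := by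
  have hw : D.w ∈ D.evenGroup ⊔ D.oddGroup := Subgroup.mem_sup_left D.w_mem_evenGroup
  have ht : D.t ∈ D.evenGroup ⊔ D.oddGroup := by
    have := mul_mem (inv_mem (Subgroup.mem_sup_right D.w_mul_inv_mem_oddGroup)) hw
    simpa using this
  rw [eq_top_iff, ← D.closure_eq, Subgroup.closure_le]
  rintro x (⟨n, rfl⟩ | rfl)
  · rw [T_eq]
    exact mul_mem (Subgroup.mem_sup_left (D.T_mem_evenGroup (D.levelPart n).2)) (zpow_mem ht _)
  · exact hw

/-- As `G` is the free product of `J` and the group generated by `w`, the lift is determined by its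
values on `D.level`, `τ` and `w`. The identity `t = (w t⁻¹)⁻¹ w` dictates the image `β⁻¹ * α` of
`τ`. It remains to see that the lift agrees with `f` and `g` on all the turns. -/
theorem exists_amalgam_lift {P : Type} [Group P] (f : D.evenGroup →* P) (g : D.oddGroup →* P)
    (hfg : ∀ x (hx : x ∈ D.edgeGroup),
      f ⟨x, D.edgeGroup_le_evenGroup hx⟩ = g ⟨x, D.edgeGroup_le_oddGroup hx⟩) :
    ∃ θ : G →* P, (∀ x : D.evenGroup, θ x = f x) ∧ ∀ x : D.oddGroup, θ x = g x := by
  have hle := D.edgeGroup_le_evenGroup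
  have hle' := D.edgeGroup_le_oddGroup
  have hf {x y z : G} (hx : x ∈ D.evenGroup) (hy : y ∈ D.evenGroup) (hz : z ∈ D.evenGroup)
      (e : x * y = z) : f ⟨x, hx⟩ * f ⟨y, hy⟩ = f ⟨z, hz⟩ := by
    rw [← map_mul]; congr 1; exact Subtype.ext e
  have hg {x y z : G} (hx : x ∈ D.oddGroup) (hy : y ∈ D.oddGroup) (hz : z ∈ D.oddGroup)
      (e : x * y = z) : g ⟨x, hx⟩ * g ⟨y, hy⟩ = g ⟨z, hz⟩ := by
    rw [← map_mul]; congr 1; exact Subtype.ext e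
  have hwA := D.w_mem_evenGroup
  have hwB := D.w_mul_inv_mem_oddGroup
  let κ : D.level →* P := f.comp
    ((D.T.comp D.level.subtype).codRestrict D.evenGroup fun l => D.T_mem_evenGroup l.2)
  have hκf (l : D.level) : κ l = f ⟨D.T l, D.T_mem_evenGroup l.2⟩ := rfl
  have hκg (l : D.level) : κ l = g ⟨D.T l, D.T_mem_oddGroup l.2⟩ :=
    hfg _ (D.T_mem_edgeGroup l.2)
  have hα (l : D.level) :
      f ⟨_, hwA⟩ * κ l = f ⟨_, hle (D.conj_T_mem_edgeGroup l.2)⟩ * f ⟨_, hwA⟩ := by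
    have h := mul_mem hwA (D.T_mem_evenGroup l.2)
    rw [hκf, hf _ _ h rfl, hf _ hwA h (by group)]
  have hβ (l : D.level) :
      g ⟨_, hwB⟩ * κ l = f ⟨_, hle (D.conj_T_mem_edgeGroup l.2)⟩ * g ⟨_, hwB⟩ := by
    have h := mul_mem hwB (D.T_mem_oddGroup l.2)
    rw [hκg, hfg _ (D.conj_T_mem_edgeGroup l.2), hg _ _ h rfl, hg _ hwB h]
    rw [D.conj_T_eq]; group
  set α := f ⟨_, hwA⟩ with hαdef
  set β := g ⟨_, hwB⟩ with hβdef
  -- Both `α` and `β` conjugate `κ l` to the image of the same element `w l w⁻¹` of the edge group.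
  have hc (l : D.level) : Commute (κ l) (β⁻¹ * α) := by
    rw [commute_iff_eq, mul_assoc, hα, ← mul_assoc, ← mul_assoc]
    congr 1
    rw [eq_inv_mul_iff_mul_eq, ← mul_assoc, hβ, mul_inv_cancel_right]
  obtain ⟨θ, hθT, hθw⟩ := D.exists_lift (D.extend κ (β⁻¹ * α) hc) α
  have hθT' (n) : θ (D.T n) = D.extend κ (β⁻¹ * α) hc n := DFunLike.congr_fun hθT n
  have hθl (l : D.level) : θ (D.T l) = κ l := by rw [hθT', extend_coe]
  have hθt : θ D.t = β⁻¹ * α := by rw [t, hθT', extend_τ]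
  have hθβ : θ (D.w * D.t⁻¹) = β := by
    rw [map_mul, map_inv, hθt, hθw]; group
  have hm := D.m_nonpos
  have hM := D.M_pos
  -- Consecutive edge turns determine each other: two-sided multiplication by `w` or by `w t⁻¹`,
  -- alternately, leads from one to the next. The first relation lives in the even group, the second
  -- in the odd group.
  have hodd {i : ℤ} (h1 : D.edgeTurn (2 * i) ∈ D.edgeGroup)
      (h2 : D.edgeTurn (2 * i - 1) ∈ D.edgeGroup) :
      α * f ⟨_, hle h1⟩ * α = f ⟨_, hle h2⟩ := by
    rw [hf _ _ (mul_mem hwA (hle h1)) rfl, hf _ _ (hle h2)]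
    rw [edgeTurn_even, edgeTurn_odd]; group
  have heven {i : ℤ} (h1 : D.edgeTurn (2 * i) ∈ D.edgeGroup)
      (h2 : D.edgeTurn (2 * (i + 1) - 1) ∈ D.edgeGroup) :
      β * f ⟨_, hle h1⟩ * β = f ⟨_, hle h2⟩ := by
    rw [hfg _ h1, hfg _ h2, hg _ _ (mul_mem hwB (hle' h1)) rfl, hg _ _ (hle' h2)]
    rw [edgeTurn_even_eq, edgeTurn_odd_eq, add_sub_cancel_right]; group
  have hθodd (i : ℤ) : θ (D.edgeTurn (2 * i - 1)) = α * θ (D.edgeTurn (2 * i)) * α := by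
    rw [← hθw, ← map_mul, ← map_mul, edgeTurn_odd, edgeTurn_even]; congr 1; group
  have hθeven (i : ℤ) :
      θ (D.edgeTurn (2 * (i + 1) - 1)) = β * θ (D.edgeTurn (2 * i)) * β := by
    rw [← hθβ, ← map_mul, ← map_mul, edgeTurn_odd_eq, edgeTurn_even_eq, add_sub_cancel_right]
    congr 1; group
  -- Start from the trivial turn at `0` and move along the interval in both directions. Since `m ≤ 0
  -- < M`, no intermediate index leaves it.
  have hθe (k : ℤ) : ∀ (h1 : D.m ≤ k) (h2 : k < D.M),
      θ (D.edgeTurn k) = f ⟨_, hle (D.edgeTurn_mem h1 h2)⟩ := by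
    induction k using Int.induction_on with
    | zero =>
      intro h1 h2
      have : (⟨_, hle (D.edgeTurn_mem h1 h2)⟩ : D.evenGroup) = 1 := Subtype.ext D.edgeTurn_zero
      rw [this, edgeTurn_zero, map_one, map_one]
    | succ k ih =>
      intro h1 h2
      have ih := ih (by omega) (by omega)
      obtain ⟨i, hi | hi⟩ := exists_eq_two_mul_or (k : ℤ)
      · simp only [hi] at ih ⊢
        simp only [show 2 * i + 1 = 2 * (i + 1) - 1 by ring]
        rw [hθeven, ih,
          heven (D.edgeTurn_mem (by omega) (by omega)) (D.edgeTurn_mem (by omega) (by omega))]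
      · simp only [hi] at ih ⊢
        simp only [sub_add_cancel]
        rw [hθodd,
          ← hodd (D.edgeTurn_mem (by omega) (by omega))
            (D.edgeTurn_mem (by omega) (by omega))] at ih
        exact mul_left_cancel (mul_right_cancel ih)
    | pred k ih =>
      intro h1 h2
      have ih := ih (by omega) (by omega)
      obtain ⟨i, hi | hi⟩ := exists_eq_two_mul_or (-k : ℤ)
      · simp only [hi] at ih ⊢
        rw [hθodd, ih,
          hodd (D.edgeTurn_mem (by omega) (by omega)) (D.edgeTurn_mem (by omega) (by omega))]
      · obtain ⟨i, rfl⟩ : ∃ j, i = j + 1 := ⟨i - 1, by ring⟩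
        simp only [hi] at ih ⊢
        simp only [show 2 * (i + 1) - 1 - 1 = 2 * i by ring]
        rw [hθeven,
          ← heven (D.edgeTurn_mem (by omega) (by omega))
            (D.edgeTurn_mem (by omega) (by omega))] at ih
        exact mul_left_cancel (mul_right_cancel ih)
  have hθf (x : G) (hx : x ∈ D.evenGroup) : θ x = f ⟨x, hx⟩ := by
    induction hx using Subgroup.closure_induction with
    | mem x hx =>
      rcases hx with ⟨j, hj, rfl⟩ | ⟨i, ⟨hi, hi'⟩, rfl⟩
      · exact hθl ⟨j, hj⟩
      · have hx' := D.evenTurn_mem hi hi'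
        change _ = f ⟨_, hx'⟩
        -- A slab centred at the top height `M` has no plane above it inside the interval, so its
        -- turn is recovered from the plane below.
        rcases hi'.lt_or_eq with h2 | h2
        · have e : D.edgeTurn (2 * i) * D.w = D.evenTurn i := by rw [edgeTurn_even]; group
          rw [← hf (hle (D.edgeTurn_mem hi h2)) hwA hx' e, ← hθe _ hi h2,
            ← hαdef, ← hθw, ← map_mul, e]
        · have e : D.w * D.evenTurn i = D.edgeTurn (2 * i - 1) := by rw [edgeTurn_odd]
          have h3 : D.m ≤ 2 * i - 1 := by omega
          have h4 : 2 * i - 1 < D.M := by omega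
          have h5 := hf hwA hx' (hle (D.edgeTurn_mem h3 h4)) e
          rw [← hθe _ h3 h4, ← e, map_mul, hθw] at h5
          exact (mul_left_cancel h5).symm
    | one => rw [map_one]; exact (map_one f).symm
    | mul x y hx hy ihx ihy => rw [map_mul, ihx, ihy]; exact hf _ _ _ rfl
    | inv x hx ihx => rw [map_inv, ihx]; exact (map_inv f _).symm
  refine ⟨θ, fun x => hθf x x.2, fun ⟨x, hx⟩ => ?_⟩
  change θ x = _
  induction hx using Subgroup.closure_induction with
  | mem x hx =>
    rcases hx with ⟨j, hj, rfl⟩ | ⟨i, ⟨hi, hi'⟩, rfl⟩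
    · exact (hθl ⟨j, hj⟩).trans (hκg ⟨j, hj⟩)
    · have hx' := D.oddTurn_mem hi hi'
      change _ = g ⟨_, hx'⟩
      -- Symmetrically, when the centre `2 * i + 1` is the bottom height `m`, only the plane above
      -- the slab is available.
      rcases lt_or_ge (2 * i) D.m with h1 | h1
      · have e : D.w * D.t⁻¹ * D.oddTurn i = D.edgeTurn (2 * (i + 1) - 1) := by
          rw [edgeTurn_odd_eq, add_sub_cancel_right]
        have h3 : D.m ≤ 2 * (i + 1) - 1 := by omega
        have h4 : 2 * (i + 1) - 1 < D.M := by omega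
        have h5 := hg hwB hx' (hle' (D.edgeTurn_mem h3 h4)) e
        rw [← hfg _ (D.edgeTurn_mem h3 h4), ← hθe _ h3 h4, ← e, map_mul, hθβ] at h5
        exact (mul_left_cancel h5).symm
      · have e : D.edgeTurn (2 * i) * (D.w * D.t⁻¹) = D.oddTurn i := by
          rw [edgeTurn_even_eq]; group
        have h2 : 2 * i < D.M := by omega
        rw [← hg (hle' (D.edgeTurn_mem h1 h2)) hwB hx' e, ← hfg _ (D.edgeTurn_mem h1 h2),
          ← hθe _ h1 h2, ← hβdef, ← hθβ, ← map_mul, e]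
  | one => rw [map_one]; exact (map_one g).symm
  | mul x y hx hy ihx ihy => rw [map_mul, ihx, ihy]; exact hg _ _ _ rfl
  | inv x hx ihx => rw [map_inv, ihx]; exact (map_inv g _).symm

theorem splitsAsAmalgam : SplitsAsAmalgam D.evenGroup D.oddGroup D.edgeGroup :=
  .of_exists_lift D.edgeGroup_le_evenGroup D.edgeGroup_le_oddGroup D.edgeGroup_ne_evenGroup
    D.edgeGroup_ne_oddGroup D.exists_amalgam_lift D.evenGroup_sup_oddGroup

end HeightData

/-! ### The edge group as a free product -/

/-- A function to a group `K` acts on `K × ι` by left multiplication in each fibre. -/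
def fibreMul {K ι : Type*} [Group K] : (ι → K) →* Equiv.Perm (K × ι) where
  toFun f :=
    { toFun := fun x => (f x.2 * x.1, x.2)
      invFun := fun x => ((f x.2)⁻¹ * x.1, x.2)
      left_inv := fun x => by simp
      right_inv := fun x => by simp }
  map_one' := by ext x <;> simp
  map_mul' f g := by ext x <;> simp [mul_assoc]

theorem fibreMul_apply {K ι : Type*} [Group K] (f : ι → K) (x : K × ι) :
    fibreMul f x = (f x.2 * x.1, x.2) := rfl

namespace HeightData

variable {J G : Type} [CommGroup J] [Group G] (D : HeightData J G)

/-- The indices of the edges that give free generators of the edge group. -/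
abbrev FreeIndex : Type := {k : ℤ // (D.m ≤ k ∧ k < D.M) ∧ k ≠ 0}

/-- The abstract group that the edge group is isomorphic to. -/
abbrev EdgeModel : Type := Monoid.Coprod (Monoid.Coprod D.level D.level) (FreeGroup D.FreeIndex)

/-- The inclusions of the two factors `D.level`. -/
def modelLevel (k : ℤ) : D.level →* D.EdgeModel :=
  if Even k then Monoid.Coprod.inl.comp Monoid.Coprod.inl
  else Monoid.Coprod.inl.comp Monoid.Coprod.inr

/-- The element of the model that belongs to the edge `k`. -/
def modelTurn (k : ℤ) : D.EdgeModel :=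
  if h : (D.m ≤ k ∧ k < D.M) ∧ k ≠ 0 then Monoid.Coprod.inr (FreeGroup.of ⟨k, h⟩) else 1

/-- The homomorphism from the model to `G`. -/
def modelHom : D.EdgeModel →* G :=
  Monoid.Coprod.lift
    (Monoid.Coprod.lift (D.T.comp D.level.subtype)
      ((MulAut.conj D.w).toMonoidHom.comp (D.T.comp D.level.subtype)))
    (FreeGroup.lift fun k => D.edgeTurn k)

/-- The action of `τ` on the fibres over the edges of the base copy. -/
def modelShift : Equiv.Perm (D.EdgeModel × ℤ) :=
  Equiv.prodCongr (Equiv.refl _) (Equiv.addRight 2)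

/-- The action of `w` on the fibres over the edges of the base copy. -/
def modelFlip : Equiv.Perm (D.EdgeModel × ℤ) :=
  fibreMul D.modelTurn * Equiv.prodCongr (Equiv.refl _) (Equiv.subLeft (-1))

theorem modelShift_zpow (i : ℤ) (x : D.EdgeModel × ℤ) :
    (D.modelShift ^ i) x = (x.1, x.2 + 2 * i) := by
  induction i using Int.induction_on generalizing x with
  | zero => simp
  | succ i ih =>
    rw [zpow_add_one, Equiv.Perm.mul_apply, ih]
    simp [modelShift]; ring
  | pred i ih =>
    rw [zpow_sub_one, Equiv.Perm.mul_apply, ih]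
    simp [modelShift, Equiv.Perm.inv_def]; ring

theorem modelFlip_apply (x : D.EdgeModel × ℤ) :
    D.modelFlip x = (D.modelTurn (-1 - x.2) * x.1, -1 - x.2) := rfl

/-- Any permutation may serve as the image of the free letter `w`. For `J` one only needs the shift
by 2 to commute with `D.level`, which holds because the factor acting over the plane `k` depends on
the parity of `k` alone. -/
theorem exists_model_action : ∃ ψ : G →* Equiv.Perm (D.EdgeModel × ℤ),
    (∀ (l : D.level) x, ψ (D.T l) x = (D.modelLevel x.2 l * x.1, x.2)) ∧
    (∀ (i : ℤ) x, ψ (D.t ^ i) x = (x.1, x.2 + 2 * i)) ∧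
    ∀ x, ψ D.w x = (D.modelTurn (-1 - x.2) * x.1, -1 - x.2) := by
  have hc (l : D.level) :
      Commute (fibreMul.comp (MonoidHom.pi D.modelLevel) l) D.modelShift := by
    refine Equiv.ext fun x => ?_
    have : D.modelLevel (x.2 + 2) = D.modelLevel x.2 := by simp [modelLevel]
    simp [modelShift, fibreMul_apply, this]
  obtain ⟨ψ, hT, hw⟩ := D.exists_lift
    (D.extend (fibreMul.comp (MonoidHom.pi D.modelLevel)) D.modelShift hc) D.modelFlip
  have hT' (n : J) : ψ (D.T n) = D.extend (fibreMul.comp (MonoidHom.pi D.modelLevel))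
    D.modelShift hc n := DFunLike.congr_fun hT n
  refine ⟨ψ, fun l x => ?_, fun i x => ?_, fun x => ?_⟩
  · rw [hT', extend_coe]; rfl
  · rw [map_zpow, t, hT', extend_τ, modelShift_zpow]
  · rw [hw, modelFlip_apply]

theorem modelTurn_zero : D.modelTurn 0 = 1 := by simp [modelTurn]

/-- Each generator of the edge group carries the fibre over plane `0` back to itself and multiplies
it by the corresponding model element. The first coordinate thus recovers the model element from its
image in `G`, which gives injectivity. -/
theorem model_action {ψ : G →* Equiv.Perm (D.EdgeModel × ℤ)}
    (hl : ∀ (l : D.level) x, ψ (D.T l) x = (D.modelLevel x.2 l * x.1, x.2))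
    (ht : ∀ (i : ℤ) x, ψ (D.t ^ i) x = (x.1, x.2 + 2 * i))
    (hw : ∀ x, ψ D.w x = (D.modelTurn (-1 - x.2) * x.1, -1 - x.2)) (κ κ' : D.EdgeModel) :
    ψ (D.modelHom κ) (κ', 0) = (κ * κ', 0) := by
  -- Triviality of the turn at `0` identifies the fibres over the planes `-1` and `0`.
  have hw0 (κ : D.EdgeModel) : ψ D.w (κ, -1) = (κ, 0) := by simp [hw, modelTurn_zero]
  have hw1 (κ : D.EdgeModel) : ψ (D.w⁻¹) (κ, 0) = (κ, -1) := by
    rw [map_inv, Equiv.Perm.inv_eq_iff_eq, hw0]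
  have hinv {M' : Type} [Group M'] (f : M' →* D.EdgeModel) (x : M')
      (h : ∀ κ', ψ (D.modelHom (f x)) (κ', 0) = (f x * κ', 0)) (κ' : D.EdgeModel) :
      ψ (D.modelHom (f x⁻¹)) (κ', 0) = (f x⁻¹ * κ', 0) := by
    rw [map_inv, map_inv, map_inv, Equiv.Perm.inv_eq_iff_eq, h, mul_inv_cancel_left]
  induction κ using Monoid.Coprod.induction_on generalizing κ' with
  | inl x =>
    induction x using Monoid.Coprod.induction_on generalizing κ' with
    | inl l =>
      simp only [modelHom, Monoid.Coprod.lift_apply_inl, MonoidHom.comp_apply,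
        Subgroup.subtype_apply]
      rw [hl]
      simp [modelLevel]
    | inr l =>
      simp only [modelHom, Monoid.Coprod.lift_apply_inl, Monoid.Coprod.lift_apply_inr,
        MonoidHom.comp_apply, Subgroup.subtype_apply, MulEquiv.coe_toMonoidHom, MulAut.conj_apply]
      rw [map_mul, map_mul, Equiv.Perm.mul_apply, Equiv.Perm.mul_apply, hw1, hl, hw0]
      simp [modelLevel]
    | mul x y hx hy =>
      rw [map_mul, map_mul, map_mul, Equiv.Perm.mul_apply, hy, hx, mul_assoc]
  | inr x =>
    induction x using FreeGroup.induction_on generalizing κ' with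
    | C1 => simp
    | of k =>
      have h1 : D.modelTurn k = Monoid.Coprod.inr (FreeGroup.of k) := by
        rw [modelTurn, dif_pos k.2]
      have h2 : D.modelHom (Monoid.Coprod.inr (FreeGroup.of k)) = D.edgeTurn k := by
        simp [modelHom]
      rw [h2, ← h1]
      obtain ⟨i, hi | hi⟩ := exists_eq_two_mul_or (k : ℤ)
      · rw [hi, edgeTurn_even, evenTurn]
        simp only [map_mul, Equiv.Perm.mul_apply]
        rw [hw1, ht, hw, ht]
        simp
      · rw [hi, edgeTurn_odd, evenTurn]
        simp only [map_mul, Equiv.Perm.mul_apply]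
        rw [ht _ (κ', 0), hw (κ', _), ht]
        have : -1 - ((0 : ℤ) + 2 * -i) + 2 * -i = -1 := by ring
        simp only [this, hw0]
        congr 3
        ring
    | inv_of k ih => exact hinv (Monoid.Coprod.inr) _ ih κ'
    | mul x y hx hy =>
      rw [map_mul, map_mul, map_mul, Equiv.Perm.mul_apply, hy, hx, mul_assoc]
  | mul x y hx hy =>
    rw [map_mul, map_mul, Equiv.Perm.mul_apply, hy, hx, mul_assoc]

theorem modelHom_injective : Function.Injective D.modelHom := by
  obtain ⟨ψ, hl, ht, hw⟩ := D.exists_model_action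
  intro x y hxy
  have hx := D.model_action hl ht hw x 1
  have hy := D.model_action hl ht hw y 1
  rw [hxy, hy] at hx
  simpa using (congrArg Prod.fst hx).symm

theorem range_modelHom : D.modelHom.range = D.edgeGroup := by
  apply le_antisymm
  · rintro _ ⟨κ, rfl⟩
    induction κ using Monoid.Coprod.induction_on with
    | inl x =>
      induction x using Monoid.Coprod.induction_on with
      | inl l => exact D.T_mem_edgeGroup l.2
      | inr l => exact D.conj_T_mem_edgeGroup l.2
      | mul x y hx hy => rw [map_mul, map_mul]; exact mul_mem hx hy
    | inr x =>
      induction x using FreeGroup.induction_on with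
      | C1 => simp
      | of k =>
        simpa [modelHom] using D.edgeTurn_mem k.2.1.1 k.2.1.2
      | inv_of k ih => rw [map_inv, map_inv]; exact inv_mem ih
      | mul x y hx hy => rw [map_mul, map_mul]; exact mul_mem hx hy
    | mul x y hx hy => rw [map_mul]; exact mul_mem hx hy
  · refine (Subgroup.closure_le _).2 ?_
    rintro x ((⟨j, hj, rfl⟩ | ⟨j, hj, rfl⟩) | ⟨k, ⟨hk, hk'⟩, rfl⟩)
    · exact ⟨Monoid.Coprod.inl (Monoid.Coprod.inl ⟨j, hj⟩), rfl⟩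
    · exact ⟨Monoid.Coprod.inl (Monoid.Coprod.inr ⟨j, hj⟩), rfl⟩
    · by_cases h0 : k = 0
      · rw [h0, edgeTurn_zero]; exact one_mem _
      · exact ⟨Monoid.Coprod.inr (FreeGroup.of ⟨k, ⟨hk, hk'⟩, h0⟩), by simp [modelHom]⟩

/-- The edge group is a free product. -/
theorem nonempty_edgeGroup_equiv (e : D.level ≃* Multiplicative (ℤ × ℤ)) {N : ℕ}
    (hN : D.M - D.m = N) : Nonempty (D.edgeGroup ≃* TwoTorusFreeProduct (N - 1)) := by
  have hm := D.m_nonpos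
  have hM := D.M_pos
  have hcard : Nonempty (D.FreeIndex ≃ Fin (N - 1)) := by
    let s : Finset ℤ := (Finset.Ico D.m D.M).erase 0
    have e : D.FreeIndex ≃ s := Equiv.subtypeEquivRight fun k => by simp [s, and_comm]
    have hs : s.card = N - 1 := by
      rw [Finset.card_erase_of_mem (by simp [hm, hM]), Int.card_Ico, hN, Int.toNat_natCast]
    exact ⟨e.trans (Finset.equivFinOfCardEq hs)⟩
  obtain ⟨i⟩ := hcard
  have e1 : D.EdgeModel ≃* TwoTorusFreeProduct (N - 1) :=
    MulEquiv.coprodCongr (MulEquiv.coprodCongr e e) (FreeGroup.freeGroupCongr i)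
  exact ⟨(MulEquiv.subgroupCongr D.range_modelHom.symm).trans
    ((MonoidHom.ofInjective D.modelHom_injective).symm.trans e1)⟩

end HeightData

/-! ### Gluing and heights in the cubing -/

namespace Cubing

theorem continuous_mk (s : CubeGroup) : Continuous (mk s) :=
  continuous_quot_mk.comp continuous_sigmaMk

theorem isOpen_iff {O : Set Cubing} : IsOpen O ↔ ∀ s, IsOpen (mk s ⁻¹' O) :=
  (isQuotientMap_quot_mk.isOpen_preimage (f := Quot.mk CubingRel) (s := O)).symm.trans
    isOpen_sigma_iff

theorem exists_eq_mk (ξ : Cubing) : ∃ s v, ξ = mk s v := by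
  obtain ⟨⟨s, v⟩, rfl⟩ := Quot.exists_rep ξ
  exact ⟨s, v, rfl⟩

theorem smul_mk (g s : CubeGroup) (v : Fin 3 → ℝ) : g • mk s v = mk (g * s) v := rfl

instance : ContinuousConstSMul CubeGroup Cubing where
  continuous_const_smul g := continuous_def.2 fun _ hO =>
    isOpen_iff.2 fun s => isOpen_iff.1 hO (g * s)

theorem mk_shift (s : CubeGroup) (v : Fin 3 → ℝ) (i : Fin 3) :
    mk (s * CubeGroup.transl i) v = mk s (v + Pi.single i 2) :=
  Quot.sound (.shift s v i)

theorem mk_flip (s : CubeGroup) {v : Fin 3 → ℝ} (hv : ∀ i, v i ∈ Set.Icc (-1 : ℝ) 0) :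
    mk (s * CubeGroup.gen .a) v = mk s (-v) :=
  Quot.sound (.flip s v hv)

theorem mk_shift_zpow (s : CubeGroup) (v : Fin 3 → ℝ) (i : Fin 3) (k : ℤ) :
    mk (s * CubeGroup.transl i ^ k) v = mk s (v + Pi.single i (2 * (k : ℝ))) := by
  induction k using Int.induction_on generalizing s v with
  | zero => simp
  | succ k ih =>
    rw [zpow_add_one, ← mul_assoc, mk_shift, ih, add_assoc, ← Pi.single_add]
    congr 3
    push_cast; ring
  | pred k ih =>
    have h := mk_shift (s * CubeGroup.transl i ^ (-(k : ℤ) - 1)) (v - Pi.single i 2) i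
    rw [mul_assoc, ← zpow_add_one, sub_add_cancel, sub_add_cancel, ih] at h
    rw [← h, sub_eq_add_neg, add_assoc, ← Pi.single_neg, ← Pi.single_add]
    congr 3
    push_cast; ring

theorem mk_mul_translHom (s : CubeGroup) (v : Fin 3 → ℝ) (n : Multiplicative (Fin 3 → ℤ)) :
    mk (s * CubeGroup.translHom n) v = mk s (v + fun i => 2 * (n.toAdd i : ℝ)) := by
  have h : CubeGroup.translHom n = CubeGroup.transl 0 ^ (n.toAdd 0) *
    CubeGroup.transl 1 ^ (n.toAdd 1) * CubeGroup.transl 2 ^ (n.toAdd 2) := rfl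
  rw [h, ← mul_assoc, ← mul_assoc, mk_shift_zpow, mk_shift_zpow, mk_shift_zpow]
  congr 1
  funext i
  fin_cases i <;> simp

theorem height_add (p q r : ℤ) (v v' : Fin 3 → ℝ) :
    height p q r (v + v') = height p q r v + height p q r v' := by
  simp only [height, Pi.add_apply]; ring

theorem height_neg (p q r : ℤ) (v : Fin 3 → ℝ) : height p q r (-v) = -height p q r v := by
  simp only [height, Pi.neg_apply]; ring

theorem height_single (p q r : ℤ) (i : Fin 3) (u : ℝ) :
    height p q r (Pi.single i u) = (![p, q, r] i : ℤ) * u := by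
  fin_cases i <;> simp [height]

theorem continuous_height (p q r : ℤ) : Continuous (height p q r) := by
  unfold height; fun_prop

/-- The least height on the cube `[0,1]³`. -/
def lowest (p q r : ℤ) : ℤ := min p 0 + min q 0 + min r 0

/-- The greatest height on the cube `[0,1]³`. -/
def highest (p q r : ℤ) : ℤ := max p 0 + max q 0 + max r 0

theorem coef_mul_mem (p : ℤ) {x : ℝ} (hx : x ∈ Set.Icc (0 : ℝ) 1) :
    ((min p 0 : ℤ) : ℝ) ≤ p * x ∧ p * x ≤ ((max p 0 : ℤ) : ℝ) := by
  obtain ⟨h0, h1⟩ := hx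
  rcases le_total p 0 with h | h
  · have h' : (p : ℝ) ≤ 0 := by exact_mod_cast h
    rw [min_eq_left h, max_eq_right h, Int.cast_zero]
    constructor <;> nlinarith
  · have h' : (0 : ℝ) ≤ p := by exact_mod_cast h
    rw [min_eq_right h, max_eq_left h, Int.cast_zero]
    constructor <;> nlinarith

theorem height_mem_of_mem_cube (p q r : ℤ) {v : Fin 3 → ℝ} (hv : ∀ i, v i ∈ Set.Icc (0 : ℝ) 1) :
    (lowest p q r : ℝ) ≤ height p q r v ∧ height p q r v ≤ (highest p q r : ℝ) := by
  have h0 := coef_mul_mem p (hv 0)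
  have h1 := coef_mul_mem q (hv 1)
  have h2 := coef_mul_mem r (hv 2)
  simp only [lowest, highest, height, Int.cast_add]
  constructor <;> linarith

theorem exists_mem_cube_height_eq (p q r : ℤ) {c : ℝ} (h : (lowest p q r : ℝ) ≤ c)
    (h' : c ≤ (highest p q r : ℝ)) :
    ∃ v : Fin 3 → ℝ, (∀ i, v i ∈ Set.Icc (0 : ℝ) 1) ∧ height p q r v = c := by
  have key (p : ℤ) : ∃ x ∈ Set.Icc (0 : ℝ) 1, ∃ y ∈ Set.Icc (0 : ℝ) 1,
      p * x = ((min p 0 : ℤ) : ℝ) ∧ p * y = ((max p 0 : ℤ) : ℝ) := by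
    rcases le_total p 0 with h | h
    · exact ⟨1, by simp, 0, by simp, by simp [h], by simp [h]⟩
    · exact ⟨0, by simp, 1, by simp, by simp [h], by simp [h]⟩
  obtain ⟨x0, hx0, y0, hy0, e0, f0⟩ := key p
  obtain ⟨x1, hx1, y1, hy1, e1, f1⟩ := key q
  obtain ⟨x2, hx2, y2, hy2, e2, f2⟩ := key r
  have hx : ![x0, x1, x2] ∈ Set.univ.pi fun _ : Fin 3 => Set.Icc (0 : ℝ) 1 := by
    intro i _; fin_cases i <;> assumption
  have hy : ![y0, y1, y2] ∈ Set.univ.pi fun _ : Fin 3 => Set.Icc (0 : ℝ) 1 := by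
    intro i _; fin_cases i <;> assumption
  have hpre : IsPreconnected (Set.univ.pi fun _ : Fin 3 => Set.Icc (0 : ℝ) 1) :=
    (convex_pi fun _ _ => convex_Icc (0 : ℝ) 1).isPreconnected
  obtain ⟨v, hv, hvc⟩ := hpre.intermediate_value hx hy (continuous_height p q r).continuousOn
    (show c ∈ Set.Icc _ _ from ⟨by simpa [height, e0, e1, e2, lowest] using h,
      by simpa [height, f0, f1, f2, highest] using h'⟩)
  exact ⟨v, fun i => hv i trivial, hvc⟩

theorem highest_sub_lowest (p q r : ℤ) :
    highest p q r - lowest p q r = ((p.natAbs + q.natAbs + r.natAbs : ℕ) : ℤ) := by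
  simp only [highest, lowest]; omega

end Cubing

/-! ### Height data of the cubing -/

open Cubing CubeGroup in
/-- Height data on `S` for the height function `p, q, r`. The free letter is `a` or its inverse,
so that some height `1` plane is glued along it. -/
structure CubeHeight (p q r : ℤ) extends HeightData (Multiplicative (Fin 3 → ℤ)) CubeGroup where
  ofData ::
  T_eq : T = translHom
  χ_eq : ∀ n, (χ n).toAdd = p * n.toAdd 0 + q * n.toAdd 1 + r * n.toAdd 2
  w_eq : (w = gen .a ∧ m = lowest p q r ∧ M = highest p q r) ∨
    (w = (gen .a)⁻¹ ∧ m = -highest p q r ∧ M = -lowest p q r)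

namespace CubeHeight

open Cubing CubeGroup

theorem exists_bezout {p q r : ℤ} (h : Int.gcd p (Int.gcd q r) = 1) :
    ∃ x y z : ℤ, p * x + q * y + r * z = 1 := by
  have h1 := Int.gcd_eq_gcd_ab p (Int.gcd q r)
  have h2 := Int.gcd_eq_gcd_ab q r
  rw [h] at h1
  refine ⟨Int.gcdA p (Int.gcd q r), Int.gcdA q r * Int.gcdB p (Int.gcd q r),
    Int.gcdB q r * Int.gcdB p (Int.gcd q r), ?_⟩
  rw [h2] at h1 ⊢
  push_cast at h1
  linarith

theorem nonempty {p q r : ℤ} (h : Int.gcd p (Int.gcd q r) = 1) : Nonempty (CubeHeight p q r) := by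
  obtain ⟨x, y, z, hxyz⟩ := exists_bezout h
  let χ : Multiplicative (Fin 3 → ℤ) →* Multiplicative ℤ := MonoidHom.mk'
    (fun n => .ofAdd (p * n.toAdd 0 + q * n.toAdd 1 + r * n.toAdd 2)) fun n n' => by
      rw [← ofAdd_add]
      congr 1
      simp only [toAdd_mul, Pi.add_apply]; ring
  have hτ : χ (.ofAdd ![x, y, z]) = .ofAdd 1 := by
    exact congrArg Multiplicative.ofAdd hxyz
  have hlo : lowest p q r ≤ 0 := by simp only [lowest]; omega
  have hhi : 0 ≤ highest p q r := by simp only [highest]; omega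
  have hne : 0 < highest p q r - lowest p q r := by
    rw [highest_sub_lowest]
    have : ¬ (p = 0 ∧ q = 0 ∧ r = 0) := by rintro ⟨rfl, rfl, rfl⟩; simp at hxyz
    omega
  -- If no coefficient is positive, the cube `[0,1]³` has no positive heights. Replacing `a` by its
  -- inverse negates the interval and makes its upper end positive.
  rcases hhi.lt_or_eq with hpos | hzero
  · exact ⟨{
      T := translHom, w := gen .a, exists_lift := fun f b => CubeGroup.exists_lift f b
      closure_eq := closure_translHom_gen_a, χ := χ, τ := .ofAdd ![x, y, z], χ_τ := hτ
      m := lowest p q r, M := highest p q r, m_nonpos := hlo, M_pos := hpos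
      T_eq := rfl, χ_eq := fun _ => rfl, w_eq := Or.inl ⟨rfl, rfl, rfl⟩ }⟩
  · refine ⟨{
      T := translHom, w := (gen .a)⁻¹, exists_lift := fun f b => ?_
      closure_eq := ?_, χ := χ, τ := .ofAdd ![x, y, z], χ_τ := hτ
      m := -highest p q r, M := -lowest p q r, m_nonpos := by omega, M_pos := by omega
      T_eq := rfl, χ_eq := fun _ => rfl, w_eq := Or.inr ⟨rfl, rfl, rfl⟩ }⟩
    · obtain ⟨φ, h1, h2⟩ := CubeGroup.exists_lift f b⁻¹
      exact ⟨φ, h1, by rw [map_inv, h2, inv_inv]⟩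
    · rw [eq_top_iff, ← closure_translHom_gen_a, Subgroup.closure_le]
      rintro x (hx | rfl)
      · exact Subgroup.subset_closure (Or.inl hx)
      · rw [SetLike.mem_coe, ← inv_mem_iff]
        exact Subgroup.subset_closure (Or.inr rfl)

variable {p q r : ℤ} (E : CubeHeight p q r)

theorem M_sub_m : E.M - E.m = ((p.natAbs + q.natAbs + r.natAbs : ℕ) : ℤ) := by
  rw [← highest_sub_lowest]
  rcases E.w_eq with ⟨-, h1, h2⟩ | ⟨-, h1, h2⟩ <;> rw [h1, h2]
  ring

theorem χ_τ_eq : p * E.τ.toAdd 0 + q * E.τ.toAdd 1 + r * E.τ.toAdd 2 = 1 := by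
  rw [← E.χ_eq, E.χ_τ]; rfl

/-- The height form is surjective because it takes the value 1 at `τ`. Its kernel is a submodule of
`ℤ³`, hence free, and rank-nullity gives rank 2. -/
theorem nonempty_level_equiv : Nonempty (E.level ≃* Multiplicative (ℤ × ℤ)) := by
  let L : (Fin 3 → ℤ) →ₗ[ℤ] ℤ := Fintype.linearCombination ℤ ![p, q, r]
  have hL (n : Fin 3 → ℤ) : L n = p * n 0 + q * n 1 + r * n 2 := by
    simp [L, Fintype.linearCombination_apply, Fin.sum_univ_three, mul_comm]
  have hsurj : Function.Surjective L := fun k => ⟨k • E.τ.toAdd, by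
    rw [map_smul, hL, E.χ_τ_eq, smul_eq_mul, mul_one]⟩
  have hrank := (LinearMap.ker L).finrank_quotient_add_finrank
  rw [(L.quotKerEquivOfSurjective hsurj).finrank_eq, Module.finrank_self, Module.finrank_fin_fun]
    at hrank
  have hrank' : Module.finrank ℤ (LinearMap.ker L) = Module.finrank ℤ (ℤ × ℤ) := by
    rw [Module.finrank_prod, Module.finrank_self]; omega
  let e : LinearMap.ker L ≃ₗ[ℤ] ℤ × ℤ := LinearEquiv.ofFinrankEq _ _ hrank'
  have hmem (n : Multiplicative (Fin 3 → ℤ)) : n ∈ E.level ↔ n.toAdd ∈ LinearMap.ker L := by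
    rw [MonoidHom.mem_ker, LinearMap.mem_ker, hL, ← E.χ_eq]
    exact Multiplicative.toAdd.injective.eq_iff.symm
  let e' : E.level ≃* Multiplicative (LinearMap.ker L) :=
    { toFun := fun n => .ofAdd ⟨n.1.toAdd, (hmem _).1 n.2⟩
      invFun := fun n => ⟨.ofAdd n.toAdd.1, (hmem _).2 n.toAdd.2⟩
      left_inv := fun _ => rfl
      right_inv := fun _ => rfl
      map_mul' := fun _ _ => rfl }
  exact ⟨e'.trans e.toAddEquiv.toMultiplicative⟩

theorem nonempty_edgeGroup_equiv : Nonempty (E.edgeGroup ≃*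
    TwoTorusFreeProduct (p.natAbs + q.natAbs + r.natAbs - 1)) := by
  obtain ⟨e⟩ := E.nonempty_level_equiv
  exact E.toHeightData.nonempty_edgeGroup_equiv e E.M_sub_m

/-- The gluing of the copies `s` and `s w` preserves the level sets. -/
theorem exists_glue {c : ℝ} (h : (E.m : ℝ) ≤ c) (h' : c ≤ E.M) : ∃ v v', height p q r v = c ∧
    height p q r v' = -c ∧ ∀ s, mk (s * E.w) v' = mk s v := by
  rcases E.w_eq with ⟨hw, hm, hM⟩ | ⟨hw, hm, hM⟩
  · rw [hm] at h; rw [hM] at h'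
    obtain ⟨v, hv, hvc⟩ := exists_mem_cube_height_eq p q r h h'
    refine ⟨v, -v, hvc, by rw [height_neg, hvc], fun s => ?_⟩
    rw [hw, mk_flip s fun i => ?_, neg_neg]
    have := hv i
    simp only [Set.mem_Icc, Pi.neg_apply] at this ⊢
    constructor <;> linarith
  · rw [hm, Int.cast_neg] at h; rw [hM, Int.cast_neg] at h'
    -- For `w = a⁻¹` the flip starts from the copy `s a⁻¹`, so the two cubes exchange roles and the
    -- point of `[0,1]³` has height `-c`.
    obtain ⟨v, hv, hvc⟩ := exists_mem_cube_height_eq p q r (c := -c) (by linarith) (by linarith)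
    refine ⟨-v, v, by rw [height_neg, hvc, neg_neg], hvc, fun s => ?_⟩
    have := mk_flip (s * (gen .a)⁻¹) (v := -v) fun i => ?_
    · rw [hw, ← neg_neg v, ← this, neg_neg, inv_mul_cancel_right]
    · have := hv i
      simp only [Set.mem_Icc, Pi.neg_apply] at this ⊢
      constructor <;> linarith

/-! ### Sets in the cubing described by copy and height -/

/-- A predicate on copies and heights that is compatible with the gluing of the cubing. -/
structure Invariant (Φ : CubeGroup → ℝ → Prop) : Prop where
  shift : ∀ s n c, Φ (s * E.T n) c ↔ Φ s (c + 2 * ((E.χ n).toAdd : ℝ))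
  turn : ∀ s c, (E.m : ℝ) ≤ c → c ≤ E.M → (Φ (s * E.w) (-c) ↔ Φ s c)

variable {E}

theorem Invariant.flip {Φ : CubeGroup → ℝ → Prop} (h : E.Invariant Φ) (s : CubeGroup) {c : ℝ}
    (hc : (lowest p q r : ℝ) ≤ c) (hc' : c ≤ highest p q r) :
    Φ (s * gen .a) (-c) ↔ Φ s c := by
  rcases E.w_eq with ⟨hw, hm, hM⟩ | ⟨hw, hm, hM⟩
  · have := h.turn s c (by rwa [hm]) (by rwa [hM])
    rwa [hw] at this
  · have := h.turn (s * gen .a) (-c) (by rw [hm, Int.cast_neg]; linarith)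
      (by rw [hM, Int.cast_neg]; linarith)
    rw [hw, mul_inv_cancel_right, neg_neg] at this
    exact this.symm

variable (p q r) in
/-- The set of points whose copy and height satisfy a predicate. -/
def heightSet (Φ : CubeGroup → ℝ → Prop) : Set Cubing :=
  {ξ | ∃ s v, ξ = Cubing.mk s v ∧ Φ s (height p q r v)}

/-- An invariant predicate descends to the quotient, so membership can be tested on any
representative. Every later description of points of `X` rests on this. -/
theorem Invariant.mk_mem {Φ : CubeGroup → ℝ → Prop} (h : E.Invariant Φ) {s : CubeGroup}
    {v : Fin 3 → ℝ} : Cubing.mk s v ∈ heightSet p q r Φ ↔ Φ s (height p q r v) := by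
  let F : Cubing → Prop := Quot.lift (fun x => Φ x.1 (height p q r x.2)) (by
    rintro _ _ (⟨s, v, i⟩ | ⟨s, v, hv⟩)
    · have := h.shift s (.ofAdd (Pi.single i 1)) (height p q r v)
      rw [E.T_eq, translHom_single] at this
      refine propext (this.trans (iff_of_eq (congrArg (Φ s) ?_)))
      rw [E.χ_eq, height_add, height_single]
      fin_cases i <;> simp [mul_comm]
    · have hv' := height_mem_of_mem_cube p q r (v := -v) fun i => by
        have := hv i
        simp only [Set.mem_Icc, Pi.neg_apply] at this ⊢
        constructor <;> linarith
      have := h.flip s hv'.1 hv'.2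
      rw [height_neg, neg_neg] at this
      simpa only [height_neg] using propext this)
  refine ⟨?_, fun hΦ => ⟨s, v, rfl, hΦ⟩⟩
  rintro ⟨s', v', e, h'⟩
  have : F (Cubing.mk s v) = F (Cubing.mk s' v') := congrArg F e
  exact this.mpr h'

theorem Invariant.isOpen {Φ : CubeGroup → ℝ → Prop} (h : E.Invariant Φ)
    (hΦ : ∀ s, IsOpen {c | Φ s c}) : IsOpen (heightSet p q r Φ) := by
  refine isOpen_iff.2 fun s => ?_
  have : Cubing.mk s ⁻¹' heightSet p q r Φ = height p q r ⁻¹' {c | Φ s c} := by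
    ext v; exact h.mk_mem
  rw [this]
  exact (hΦ s).preimage (continuous_height p q r)

end CubeHeight

/-! ### Recognizing connected components -/

theorem connectedComponentIn_eq_of_separated {X : Type*} [TopologicalSpace X] {Y T O O' : Set X}
    (hT : IsPreconnected T) (hTY : T ⊆ Y) (hO : IsOpen O) (hO' : IsOpen O') (hTO : T ⊆ O)
    (hYO : Y \ T ⊆ O') (hdisj : Disjoint O O') {ξ : X} (hξ : ξ ∈ T) :
    connectedComponentIn Y ξ = T := by
  refine (Set.Subset.antisymm (fun x hx => ?_) (hT.subset_connectedComponentIn hξ hTY))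
  have hsub := connectedComponentIn_subset Y ξ
  have hC : connectedComponentIn Y ξ ⊆ O := by
    refine isPreconnected_connectedComponentIn.subset_left_of_subset_union hO hO' hdisj
      (fun y hy => ?_) ⟨ξ, mem_connectedComponentIn (hTY hξ), hTO hξ⟩
    by_cases hyT : y ∈ T
    exacts [Or.inl (hTO hyT), Or.inr (hYO ⟨hsub hy, hyT⟩)]
  by_contra hxT
  exact hdisj.le_bot ⟨hC hx, hYO ⟨hsub hx, hxT⟩⟩

/-- The translates of a preconnected set by a group that is generated by elements which move the
set to a set that it meets form a preconnected set. -/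
theorem isPreconnected_iUnion_smul_closure {G X : Type*} [Group G] [TopologicalSpace X]
    [MulAction G X] [ContinuousConstSMul G X] {S : Set G} {D : Set X} (hD : IsPreconnected D)
    (hDne : D.Nonempty) (h : ∀ σ ∈ S, (D ∩ σ • D).Nonempty) :
    IsPreconnected (⋃ g ∈ Subgroup.closure S, g • D) := by
  have hsub {g : G} (hg : g ∈ Subgroup.closure S) : g • D ⊆ ⋃ g ∈ Subgroup.closure S, g • D :=
    Set.subset_biUnion_of_mem (u := fun g : G => g • D) hg
  have hsmul {g : G} (hg : g ∈ Subgroup.closure S) :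
      g • (⋃ g ∈ Subgroup.closure S, g • D) ⊆ ⋃ g ∈ Subgroup.closure S, g • D := by
    rintro _ ⟨x, hx, rfl⟩
    simp only [Set.mem_iUnion] at hx ⊢
    obtain ⟨g', hg', x, hx, rfl⟩ := hx
    exact ⟨g * g', mul_mem hg hg', x, hx, mul_smul _ _ _⟩
  have key : ∀ g ∈ Subgroup.closure S, ∃ T ⊆ ⋃ g ∈ Subgroup.closure S, g • D,
      IsPreconnected T ∧ D ⊆ T ∧ g • D ⊆ T := by
    intro g hg
    induction hg using Subgroup.closure_induction with
    | mem σ hσ =>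
      refine ⟨D ∪ σ • D, Set.union_subset ?_ (hsub (Subgroup.subset_closure hσ)),
        hD.union' (h σ hσ) (hD.image _ (continuous_const_smul σ).continuousOn),
        Set.subset_union_left, Set.subset_union_right⟩
      simpa using hsub (one_mem (Subgroup.closure S))
    | one =>
      exact ⟨D, by simpa using hsub (one_mem (Subgroup.closure S)), hD, subset_rfl, by simp⟩
    | mul g g' hg hg' ih ih' =>
      obtain ⟨T, hT, hTc, hDT, hgT⟩ := ih
      obtain ⟨T', hT', hTc', hDT', hgT'⟩ := ih'
      refine ⟨T ∪ g • T', Set.union_subset hT ((Set.smul_set_mono hT').trans (hsmul hg)),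
        hTc.union' ?_ (hTc'.image _ (continuous_const_smul g).continuousOn),
        hDT.trans Set.subset_union_left, ?_⟩
      · exact (hDne.smul_set (a := g)).mono (Set.subset_inter hgT (Set.smul_set_mono hDT'))
      · rw [mul_smul]
        exact (Set.smul_set_mono hgT').trans Set.subset_union_right
    | inv g hg ih =>
      obtain ⟨T, hT, hTc, hDT, hgT⟩ := ih
      refine ⟨g⁻¹ • T, (Set.smul_set_mono hT).trans (hsmul (inv_mem hg)),
        hTc.image _ (continuous_const_smul g⁻¹).continuousOn, ?_, Set.smul_set_mono hDT⟩
      rwa [← Set.smul_set_subset_iff_subset_inv_smul_set]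
  obtain ⟨x, hx⟩ := hDne
  refine isPreconnected_of_forall x fun y hy => ?_
  simp only [Set.mem_iUnion] at hy
  obtain ⟨g, hg, hy⟩ := hy
  obtain ⟨T, hT, hTc, hDT, hgT⟩ := key g hg
  exact ⟨T, hT, hDT hx, hgT hy, hTc⟩

/-! ### Labels on planes and slabs -/

namespace CubeHeight

open Cubing CubeGroup

variable {p q r : ℤ} (E : CubeHeight p q r)

variable (p q r) in
/-- The points whose height differs from an integer `k` with `Ψ s k` by an element of `I`. -/
def region (I : Set ℝ) (Ψ : CubeGroup → ℤ → Prop) : Set Cubing :=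
  heightSet p q r fun s c => ∃ k : ℤ, c - k ∈ I ∧ Ψ s k

/-- A label on the planes at height `k + 1/2` that is compatible with the gluing. -/
structure EdgeLabel (Ψ : CubeGroup → ℤ → Prop) : Prop where
  shift : ∀ s n k, Ψ (s * E.T n) k ↔ Ψ s (k + 2 * (E.χ n).toAdd)
  turn : ∀ s k, E.m ≤ k → k < E.M → (Ψ (s * E.w) (-1 - k) ↔ Ψ s k)

/-- A label on the slabs around height `k` that is compatible with the gluing. -/
structure VertexLabel (Ψ : CubeGroup → ℤ → Prop) : Prop where
  shift : ∀ s n k, Ψ (s * E.T n) k ↔ Ψ s (k + 2 * (E.χ n).toAdd)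
  turn : ∀ s k, E.m ≤ k → k ≤ E.M → (Ψ (s * E.w) (-k) ↔ Ψ s k)

variable {E} {Ψ : CubeGroup → ℤ → Prop}

theorem EdgeLabel.not (h : E.EdgeLabel Ψ) : E.EdgeLabel fun s k => ¬ Ψ s k :=
  ⟨fun s n k => not_congr (h.shift s n k), fun s k hk hk' => not_congr (h.turn s k hk hk')⟩

theorem VertexLabel.not (h : E.VertexLabel Ψ) : E.VertexLabel fun s k => ¬ Ψ s k :=
  ⟨fun s n k => not_congr (h.shift s n k), fun s k hk hk' => not_congr (h.turn s k hk hk')⟩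

theorem shift_label {I : Set ℝ} (h : ∀ s n k, Ψ (s * E.T n) k ↔ Ψ s (k + 2 * (E.χ n).toAdd))
    (s : CubeGroup) (n : Multiplicative (Fin 3 → ℤ)) (c : ℝ) :
    (∃ k : ℤ, c - k ∈ I ∧ Ψ (s * E.T n) k) ↔
      ∃ k : ℤ, c + 2 * ((E.χ n).toAdd : ℝ) - k ∈ I ∧ Ψ s k := by
  constructor
  · rintro ⟨k, hk, hΨ⟩
    refine ⟨_, ?_, (h s n k).1 hΨ⟩
    convert hk using 1
    push_cast; ring
  · rintro ⟨k, hk, hΨ⟩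
    refine ⟨k - 2 * (E.χ n).toAdd, ?_, (h s n _).2 (by rwa [sub_add_cancel])⟩
    convert hk using 1
    push_cast; ring

/-- Negating a height replaces the offset `x` from `k` by the offset `1 - x` from `-1 - k`. Offsets
strictly between 0 and 1 force `m ≤ k < M`, because the ends of the interval are integers. The cases
used are `{1/2}`, for the track, and `(0, 1)`, for an open neighbourhood of it. -/
theorem EdgeLabel.invariant (h : E.EdgeLabel Ψ) {I : Set ℝ} (hI : I ⊆ Set.Ioo 0 1)
    (hsymm : ∀ x ∈ I, 1 - x ∈ I) : E.Invariant fun s c => ∃ k : ℤ, c - k ∈ I ∧ Ψ s k := by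
  refine ⟨fun s n c => shift_label h.shift s n c, fun s c hc hc' => ?_⟩
  have bound (k : ℤ) (hk : c - k ∈ I) : E.m ≤ k ∧ k < E.M := by
    have h1 := hI hk
    rw [Set.mem_Ioo] at h1
    constructor
    · have : (E.m : ℝ) < k + 1 := by linarith
      exact Int.lt_add_one_iff.1 (by exact_mod_cast this)
    · have : (k : ℝ) < E.M := by linarith
      exact_mod_cast this
  constructor
  · rintro ⟨k, hk, hΨ⟩
    have h2 : c - ((-1 - k : ℤ) : ℝ) ∈ I := by
      convert hsymm _ hk using 1
      push_cast; ring
    have h3 := bound _ h2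
    refine ⟨_, h2, (h.turn s (-1 - k) h3.1 h3.2).1 ?_⟩
    rwa [sub_sub_cancel]
  · rintro ⟨k, hk, hΨ⟩
    have h3 := bound _ hk
    refine ⟨_, ?_, (h.turn s k h3.1 h3.2).2 hΨ⟩
    convert hsymm _ hk using 1
    push_cast; ring

theorem VertexLabel.invariant (h : E.VertexLabel Ψ) :
    E.Invariant fun s c => ∃ k : ℤ, c - k ∈ Set.Ioo (-(1 / 2) : ℝ) (1 / 2) ∧ Ψ s k := by
  refine ⟨fun s n c => shift_label h.shift s n c, fun s c hc hc' => ?_⟩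
  have bound (k : ℤ) (hk : c - k ∈ Set.Ioo (-(1 / 2) : ℝ) (1 / 2)) : E.m ≤ k ∧ k ≤ E.M := by
    rw [Set.mem_Ioo] at hk
    constructor
    · have : (E.m : ℝ) < k + 1 := by linarith
      exact Int.lt_add_one_iff.1 (by exact_mod_cast this)
    · have : (k : ℝ) < E.M + 1 := by linarith
      exact Int.lt_add_one_iff.1 (by exact_mod_cast this)
  constructor
  · rintro ⟨k, hk, hΨ⟩
    have h2 : c - ((-k : ℤ) : ℝ) ∈ Set.Ioo (-(1 / 2) : ℝ) (1 / 2) := by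
      rw [Set.mem_Ioo] at hk ⊢
      push_cast
      constructor <;> linarith
    have h3 := bound _ h2
    refine ⟨_, h2, (h.turn s (-k) h3.1 h3.2).1 ?_⟩
    rwa [neg_neg]
  · rintro ⟨k, hk, hΨ⟩
    have h3 := bound _ hk
    refine ⟨_, ?_, (h.turn s k h3.1 h3.2).2 hΨ⟩
    rw [Set.mem_Ioo] at hk ⊢
    push_cast
    constructor <;> linarith

theorem isOpen_label {I : Set ℝ} (hI : IsOpen I) (Ψ : ℤ → Prop) :
    IsOpen {c : ℝ | ∃ k : ℤ, c - k ∈ I ∧ Ψ k} := by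
  simp only [Set.ofPred_exists, Set.ofPred_and]
  exact isOpen_iUnion fun k => (hI.preimage (continuous_sub_right (k : ℝ))).inter isOpen_const

theorem EdgeLabel.mk_mem_half (h : E.EdgeLabel Ψ) {s : CubeGroup} {v : Fin 3 → ℝ} :
    Cubing.mk s v ∈ region p q r {1 / 2} Ψ ↔ ∃ k : ℤ, height p q r v - k = 1 / 2 ∧ Ψ s k :=
  (h.invariant (I := {1 / 2}) (by norm_num) (by norm_num)).mk_mem

theorem EdgeLabel.invariant_Ioo (h : E.EdgeLabel Ψ) :
    E.Invariant fun s c => ∃ k : ℤ, c - k ∈ Set.Ioo (0 : ℝ) 1 ∧ Ψ s k :=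
  h.invariant subset_rfl fun x hx => by
    rw [Set.mem_Ioo] at hx ⊢
    constructor <;> linarith

theorem EdgeLabel.mk_mem_Ioo (h : E.EdgeLabel Ψ) {s : CubeGroup} {v : Fin 3 → ℝ} :
    Cubing.mk s v ∈ region p q r (Set.Ioo 0 1) Ψ ↔
      ∃ k : ℤ, height p q r v - k ∈ Set.Ioo (0 : ℝ) 1 ∧ Ψ s k :=
  h.invariant_Ioo.mk_mem

theorem EdgeLabel.isOpen (h : E.EdgeLabel Ψ) : IsOpen (region p q r (Set.Ioo 0 1) Ψ) :=
  h.invariant_Ioo.isOpen fun _ => isOpen_label isOpen_Ioo _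

theorem VertexLabel.mk_mem (h : E.VertexLabel Ψ) {s : CubeGroup} {v : Fin 3 → ℝ} :
    Cubing.mk s v ∈ region p q r (Set.Ioo (-(1 / 2)) (1 / 2)) Ψ ↔
      ∃ k : ℤ, height p q r v - k ∈ Set.Ioo (-(1 / 2) : ℝ) (1 / 2) ∧ Ψ s k :=
  h.invariant.mk_mem

theorem VertexLabel.isOpen (h : E.VertexLabel Ψ) :
    IsOpen (region p q r (Set.Ioo (-(1 / 2)) (1 / 2)) Ψ) :=
  h.invariant.isOpen fun _ => isOpen_label isOpen_Ioo _

theorem int_eq_of_mem_Ioo {a c : ℝ} {k k' : ℤ} (h : c - k ∈ Set.Ioo a (a + 1))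
    (h' : c - k' ∈ Set.Ioo a (a + 1)) : k = k' := by
  rw [Set.mem_Ioo] at h h'
  have h1 : (k : ℝ) < k' + 1 := by linarith
  have h2 : (k' : ℝ) < k + 1 := by linarith
  have h1' : k < k' + 1 := by exact_mod_cast h1
  have h2' : k' < k + 1 := by exact_mod_cast h2
  omega

/-- A height determines the index `k`, so a label and its negation cannot hold at the same point. As
both regions are open, they separate a track from the rest of the pattern. -/
theorem EdgeLabel.disjoint (h : E.EdgeLabel Ψ) : Disjoint (region p q r (Set.Ioo 0 1) Ψ)
    (region p q r (Set.Ioo 0 1) fun s k => ¬ Ψ s k) := by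
  rw [Set.disjoint_left]
  intro ξ hξ hξ'
  obtain ⟨s, v, rfl⟩ := exists_eq_mk ξ
  obtain ⟨k, hk, hΨ⟩ := h.mk_mem_Ioo.1 hξ
  obtain ⟨k', hk', hΨ'⟩ := h.not.mk_mem_Ioo.1 hξ'
  rw [← zero_add (1 : ℝ)] at hk hk'
  exact hΨ' (int_eq_of_mem_Ioo hk hk' ▸ hΨ)

theorem VertexLabel.disjoint (h : E.VertexLabel Ψ) :
    Disjoint (region p q r (Set.Ioo (-(1 / 2)) (1 / 2)) Ψ)
      (region p q r (Set.Ioo (-(1 / 2)) (1 / 2)) fun s k => ¬ Ψ s k) := by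
  rw [Set.disjoint_left]
  intro ξ hξ hξ'
  obtain ⟨s, v, rfl⟩ := exists_eq_mk ξ
  obtain ⟨k, hk, hΨ⟩ := h.mk_mem.1 hξ
  obtain ⟨k', hk', hΨ'⟩ := h.not.mk_mem.1 hξ'
  rw [show (1 / 2 : ℝ) = -(1 / 2) + 1 by norm_num] at hk hk'
  norm_num at hk hk'
  refine hΨ' (int_eq_of_mem_Ioo (a := -(1 / 2)) (c := height p q r v) (k := k)
    (k' := k') ?_ ?_ ▸ hΨ)
  all_goals
    rw [Set.mem_Ioo]
    constructor <;> linarith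

end CubeHeight

namespace CubeHeight

open Cubing CubeGroup

variable {p q r : ℤ}

/-! ### The pattern -/

theorem mk_mem_pattern (E : CubeHeight p q r) {s : CubeGroup} {v : Fin 3 → ℝ} :
    Cubing.mk s v ∈ pattern p q r ↔ ∃ k : ℤ, height p q r v - k = 1 / 2 := by
  have hlabel : E.EdgeLabel fun _ _ => True := ⟨fun _ _ _ => Iff.rfl, fun _ _ _ _ => Iff.rfl⟩
  have hmem (s : CubeGroup) (v : Fin 3 → ℝ) := hlabel.mk_mem_half (s := s) (v := v)
  simp only [and_true] at hmem
  have hfract (c : ℝ) : Int.fract c = 1 / 2 ↔ ∃ k : ℤ, c - k = 1 / 2 := by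
    rw [Int.fract_eq_iff]
    constructor
    · rintro ⟨-, -, k, hk⟩
      exact ⟨k, by linarith⟩
    · rintro ⟨k, hk⟩
      exact ⟨by norm_num, by norm_num, k, by linarith⟩
  rw [← hmem]
  constructor
  · simp only [pattern, Set.mem_iUnion]
    rintro ⟨g, c, hc, ξ, ⟨v', hv', rfl⟩, h⟩
    have h : Cubing.mk (g * 1) v' = Cubing.mk s v := h
    rw [← h, hmem, ← hfract]
    rw [Set.mem_ofPred_eq] at hv'
    rwa [hv']
  · rw [hmem, ← hfract]
    intro h
    simp only [pattern, Set.mem_iUnion]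
    exact ⟨s, _, h, Cubing.mk 1 v, ⟨v, rfl, rfl⟩, by
      change s • Cubing.mk 1 v = _
      rw [smul_mk, mul_one]⟩

theorem mk_notMem_pattern (E : CubeHeight p q r) {s : CubeGroup} {v : Fin 3 → ℝ} :
    Cubing.mk s v ∉ pattern p q r ↔
      ∃ k : ℤ, height p q r v - k ∈ Set.Ioo (-(1 / 2) : ℝ) (1 / 2) := by
  rw [E.mk_mem_pattern]
  set c := height p q r v
  constructor
  · intro h
    refine ⟨round c, ?_⟩
    have h1 := abs_le.1 (abs_sub_round c)
    refine ⟨lt_of_le_of_ne h1.1 fun h2 => h ⟨round c - 1, ?_⟩,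
      lt_of_le_of_ne h1.2 fun h2 => h ⟨round c, h2⟩⟩
    push_cast
    linarith
  · rintro ⟨k, hk⟩ ⟨k', hk'⟩
    rw [Set.mem_Ioo] at hk
    have h1 : (k' : ℝ) < k := by linarith
    have h2 : (k : ℝ) < k' + 1 := by linarith
    have h1' : k' < k := by exact_mod_cast h1
    have h2' : k < k' + 1 := by exact_mod_cast h2
    omega

theorem smul_pattern (E : CubeHeight p q r) (g : CubeGroup) :
    g • pattern p q r = pattern p q r := by
  ext ξ
  obtain ⟨s, v, rfl⟩ := exists_eq_mk ξ
  rw [Set.mem_smul_set_iff_inv_smul_mem, smul_mk, E.mk_mem_pattern, E.mk_mem_pattern]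

/-! ### Planes -/

theorem exists_height_add (E : CubeHeight p q r) (c : ℝ) (v : Fin 3 → ℝ) :
    ∃ v', height p q r v' = height p q r v + c := by
  refine ⟨v + fun i => c * (E.τ.toAdd i : ℝ), ?_⟩
  rw [height_add]
  have h : (p * E.τ.toAdd 0 + q * E.τ.toAdd 1 + r * E.τ.toAdd 2 : ℝ) = 1 := by
    exact_mod_cast E.χ_τ_eq
  congr 1
  simp only [height]
  linear_combination c * h

theorem exists_height_eq (E : CubeHeight p q r) (c : ℝ) : ∃ v, height p q r v = c := by
  obtain ⟨v, hv⟩ := E.exists_height_add c 0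
  exact ⟨v, by simpa [height] using hv⟩

theorem plane_nonempty (E : CubeHeight p q r) (c : ℝ) : (plane p q r c).Nonempty := by
  obtain ⟨v, hv⟩ := E.exists_height_eq c
  exact ⟨_, v, hv, rfl⟩

theorem mk_mul_T (E : CubeHeight p q r) (s : CubeGroup) (n : Multiplicative (Fin 3 → ℤ))
    (v : Fin 3 → ℝ) :
    ∃ v', height p q r v' = height p q r v + 2 * ((E.χ n).toAdd : ℝ) ∧
      Cubing.mk (s * E.T n) v = Cubing.mk s v' := by
  refine ⟨_, ?_, by rw [E.T_eq]; exact mk_mul_translHom s v n⟩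
  rw [height_add, E.χ_eq]
  congr 1
  simp only [height]
  push_cast; ring

theorem χ_τ_zpow (E : CubeHeight p q r) (i : ℤ) : (E.χ (E.τ ^ i)).toAdd = i := by
  rw [map_zpow, E.χ_τ, ← ofAdd_zsmul]
  simp

theorem mk_mul_t_zpow (E : CubeHeight p q r) (s : CubeGroup) (i : ℤ) (v : Fin 3 → ℝ) :
    ∃ v', height p q r v' = height p q r v + 2 * (i : ℝ) ∧
      Cubing.mk (s * E.t ^ i) v = Cubing.mk s v' := by
  have := E.mk_mul_T s (E.τ ^ i) v
  rwa [χ_τ_zpow, map_zpow] at this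

theorem T_smul_plane_subset (E : CubeHeight p q r) (n : Multiplicative (Fin 3 → ℤ)) (c : ℝ) :
    E.T n • plane p q r c ⊆ plane p q r (c + 2 * ((E.χ n).toAdd : ℝ)) := by
  rintro _ ⟨_, ⟨v, rfl, rfl⟩, rfl⟩
  obtain ⟨v', hv', h⟩ := E.mk_mul_T 1 n v
  refine ⟨v', hv', h.symm.trans ?_⟩
  change _ = E.T n • Cubing.mk 1 v
  rw [smul_mk, one_mul, mul_one]

theorem t_zpow_smul_plane (E : CubeHeight p q r) (i : ℤ) (c : ℝ) :
    E.t ^ i • plane p q r c = plane p q r (c + 2 * (i : ℝ)) := by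
  have key (i : ℤ) (c : ℝ) : E.t ^ i • plane p q r c ⊆ plane p q r (c + 2 * (i : ℝ)) := by
    have := E.T_smul_plane_subset (E.τ ^ i) c
    rwa [χ_τ_zpow, map_zpow] at this
  refine (key i c).antisymm ?_
  rw [Set.subset_smul_set_iff, ← zpow_neg]
  refine (key (-i) _).trans_eq ?_
  congr 1
  push_cast; ring

theorem glue_nonempty (E : CubeHeight p q r) {c : ℝ} (h : (E.m : ℝ) ≤ c) (h' : c ≤ E.M) :
    (plane p q r c ∩ E.w • plane p q r (-c)).Nonempty := by
  obtain ⟨v, v', hv, hv', hg⟩ := E.exists_glue h h'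
  refine ⟨Cubing.mk 1 v, ⟨v, hv, rfl⟩, Cubing.mk 1 v', ⟨v', hv', rfl⟩, ?_⟩
  change E.w • Cubing.mk 1 v' = _
  rw [smul_mk, ← hg 1, one_mul, mul_one]

theorem glue_zpow_nonempty (E : CubeHeight p q r) {c : ℝ} (h : (E.m : ℝ) ≤ c) (h' : c ≤ E.M)
    (i j : ℤ) :
    (plane p q r (c + 2 * (i : ℝ)) ∩
      (E.t ^ i * E.w * E.t ^ j) • plane p q r (-c - 2 * (j : ℝ))).Nonempty := by
  have := (E.glue_nonempty h h').smul_set (a := E.t ^ i)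
  rw [Set.smul_set_inter, t_zpow_smul_plane] at this
  rwa [mul_smul, mul_smul, t_zpow_smul_plane, sub_add_cancel]

theorem isPreconnected_image_mk (s : CubeGroup) {I : Set ℝ} (hI : Convex ℝ I) :
    IsPreconnected (Cubing.mk s '' {v | height p q r v ∈ I}) := by
  have hconv : Convex ℝ {v | height p q r v ∈ I} := by
    intro v hv v' hv' a b ha hb hab
    have : height p q r (a • v + b • v') = a • height p q r v + b • height p q r v' := by
      simp [height]; ring
    rw [Set.mem_ofPred_eq, this]
    exact hI hv hv' ha hb hab
  exact hconv.isPreconnected.image _ (continuous_mk s).continuousOn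

variable (E : CubeHeight p q r)

/-- The label of the planes that belong to the base track. -/
def trackLabel (s : CubeGroup) (k : ℤ) : Prop := s * E.pos k ∈ E.edgeGroup

/-- The label of the slabs that belong to the base region at even height. -/
def evenLabel (s : CubeGroup) (k : ℤ) : Prop := ∃ i, k = 2 * i ∧ s * E.t ^ i ∈ E.evenGroup

/-- The label of the slabs that belong to the base region at odd height. -/
def oddLabel (s : CubeGroup) (k : ℤ) : Prop := ∃ i, k = 2 * i + 1 ∧ s * E.t ^ i ∈ E.oddGroup

theorem edgeLabel_track : E.EdgeLabel E.trackLabel :=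
  ⟨fun s n k => E.edge_translate s n k, fun s _ h h' => E.edge_turn s h h'⟩

theorem vertexLabel_even : E.VertexLabel E.evenLabel := by
  refine ⟨fun s n k => ⟨?_, ?_⟩, fun s k h h' => ⟨?_, ?_⟩⟩
  · rintro ⟨i, rfl, hi⟩
    exact ⟨_, by ring, (E.translate_mem_iff _ (fun _ => E.T_mem_evenGroup) s n i).1 hi⟩
  · rintro ⟨i, hk, hi⟩
    refine ⟨i - (E.χ n).toAdd, by linarith,
      (E.translate_mem_iff _ (fun _ => E.T_mem_evenGroup) s n _).2 (by rwa [sub_add_cancel])⟩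
  · rintro ⟨i, hk, hi⟩
    refine ⟨-i, by linarith, (E.even_turn s (by omega) (by omega)).1 (by rwa [neg_neg])⟩
  · rintro ⟨i, rfl, hi⟩
    exact ⟨-i, by ring, (E.even_turn s h h').2 hi⟩

theorem vertexLabel_odd : E.VertexLabel E.oddLabel := by
  refine ⟨fun s n k => ⟨?_, ?_⟩, fun s k h h' => ⟨?_, ?_⟩⟩
  · rintro ⟨i, rfl, hi⟩
    exact ⟨_, by ring, (E.translate_mem_iff _ (fun _ => E.T_mem_oddGroup) s n i).1 hi⟩
  · rintro ⟨i, hk, hi⟩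
    refine ⟨i - (E.χ n).toAdd, by linarith,
      (E.translate_mem_iff _ (fun _ => E.T_mem_oddGroup) s n _).2 (by rwa [sub_add_cancel])⟩
  · rintro ⟨i, hk, hi⟩
    refine ⟨-i - 1, by linarith, (E.odd_turn s (by omega) (by omega)).1 ?_⟩
    rwa [show -(-i - 1) - 1 = i by ring]
  · rintro ⟨i, rfl, hi⟩
    exact ⟨-i - 1, by ring, (E.odd_turn s h h').2 hi⟩

/-- The base track. -/
def track : Set Cubing := region p q r {1 / 2} E.trackLabel

/-- The base region at even height. -/
def evenRegion : Set Cubing := region p q r (Set.Ioo (-(1 / 2)) (1 / 2)) E.evenLabel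

/-- The base region at odd height. -/
def oddRegion : Set Cubing := region p q r (Set.Ioo (-(1 / 2)) (1 / 2)) E.oddLabel

theorem mk_mem_track {s : CubeGroup} {v : Fin 3 → ℝ} : Cubing.mk s v ∈ E.track ↔
    ∃ k : ℤ, height p q r v - k = 1 / 2 ∧ s * E.pos k ∈ E.edgeGroup :=
  E.edgeLabel_track.mk_mem_half

theorem mk_mem_evenRegion {s : CubeGroup} {v : Fin 3 → ℝ} : Cubing.mk s v ∈ E.evenRegion ↔
    ∃ i : ℤ, height p q r v - 2 * i ∈ Set.Ioo (-(1 / 2) : ℝ) (1 / 2) ∧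
      s * E.t ^ i ∈ E.evenGroup := by
  refine E.vertexLabel_even.mk_mem.trans ⟨?_, ?_⟩
  · rintro ⟨_, hk, i, rfl, hi⟩
    exact ⟨i, by push_cast at hk; exact hk, hi⟩
  · rintro ⟨i, hk, hi⟩
    exact ⟨_, by push_cast; exact hk, i, rfl, hi⟩

theorem mk_mem_oddRegion {s : CubeGroup} {v : Fin 3 → ℝ} : Cubing.mk s v ∈ E.oddRegion ↔
    ∃ i : ℤ, height p q r v - 2 * i ∈ Set.Ioo (1 / 2 : ℝ) (3 / 2) ∧
      s * E.t ^ i ∈ E.oddGroup := by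
  have key (c i : ℝ) : c - (2 * i + 1) ∈ Set.Ioo (-(1 / 2) : ℝ) (1 / 2) ↔
      c - 2 * i ∈ Set.Ioo (1 / 2 : ℝ) (3 / 2) := by
    simp only [Set.mem_Ioo]
    constructor <;> rintro ⟨h, h'⟩ <;> constructor <;> linarith
  refine E.vertexLabel_odd.mk_mem.trans ⟨?_, ?_⟩
  · rintro ⟨_, hk, i, rfl, hi⟩
    exact ⟨i, by push_cast at hk; exact (key _ _).1 hk, hi⟩
  · rintro ⟨i, hk, hi⟩
    exact ⟨_, by push_cast; exact (key _ _).2 hk, i, rfl, hi⟩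

/-! ### Connectedness -/

theorem glue_int_nonempty {c : ℝ} (h : (E.m : ℝ) ≤ c) (h' : c ≤ E.M) {i j : ℤ}
    {x y : ℝ} {g : CubeGroup}
    (hx : x = c + 2 * (i : ℝ)) (hy : y = -c - 2 * (j : ℝ)) (hg : g = E.t ^ i * E.w * E.t ^ j) :
    (plane p q r x ∩ g • plane p q r y).Nonempty := by
  subst hx hy hg
  exact E.glue_zpow_nonempty h h' i j

theorem T_smul_plane_nonempty {n : Multiplicative (Fin 3 → ℤ)} (hn : n ∈ E.level) (c : ℝ) :
    (plane p q r c ∩ E.T n • plane p q r c).Nonempty := by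
  have h : E.χ n = 1 := hn
  have := E.T_smul_plane_subset n c
  rw [h, toAdd_one, Int.cast_zero, mul_zero, add_zero] at this
  rw [Set.inter_eq_right.2 this]
  exact (E.plane_nonempty c).smul_set

/-- A connected piece of the base track whose translates cover it. -/
def trackPiece : Set Cubing := plane p q r (1 / 2) ∪ E.w • plane p q r (-(1 / 2))

theorem m_cast_nonpos : (E.m : ℝ) ≤ 0 := by exact_mod_cast E.m_nonpos

theorem one_le_M_cast : (1 : ℝ) ≤ E.M := by exact_mod_cast E.M_pos

theorem isPreconnected_plane (c : ℝ) : IsPreconnected (plane p q r c) :=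
  isPreconnected_image_mk (p := p) (q := q) (r := r) 1 (convex_singleton c)

theorem isPreconnected_trackPiece : IsPreconnected E.trackPiece := by
  have hm := E.m_cast_nonpos
  have hM := E.one_le_M_cast
  exact (isPreconnected_plane _).union' (E.glue_nonempty (by linarith) (by linarith))
    ((isPreconnected_plane _).image _ (continuous_const_smul E.w).continuousOn)

/-- Both planes of the piece are needed: generators from `D.level` and even turns move the first to
meet itself or the second, while conjugates by `w` and odd turns are seen from the second. -/
theorem isPreconnected_iUnion_trackPiece :
    IsPreconnected (⋃ g ∈ E.edgeGroup, g • E.trackPiece) := by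
  refine isPreconnected_iUnion_smul_closure E.isPreconnected_trackPiece
    ((E.plane_nonempty _).mono Set.subset_union_left) ?_
  rintro x ((⟨j, hj, rfl⟩ | ⟨j, hj, rfl⟩) | ⟨k, ⟨hk, hk'⟩, rfl⟩)
  · exact (E.T_smul_plane_nonempty hj _).mono (Set.inter_subset_inter Set.subset_union_left
      (Set.smul_set_mono Set.subset_union_left))
  · have := (E.T_smul_plane_nonempty hj (-(1 / 2))).smul_set (a := E.w)
    rw [Set.smul_set_inter] at this
    refine this.mono (Set.inter_subset_inter Set.subset_union_right ?_)
    refine subset_trans ?_ (Set.smul_set_mono Set.subset_union_right)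
    simp only [smul_smul, inv_mul_cancel_right]
    exact subset_rfl
  · have h1 : (E.m : ℝ) ≤ k := by exact_mod_cast hk
    have h2 : (k : ℝ) + 1 ≤ E.M := by exact_mod_cast hk'
    obtain ⟨i, rfl | rfl⟩ := HeightData.exists_eq_two_mul_or k
    · push_cast at h1 h2
      -- The gluing takes place at plane `2 * i`, and translation by `t⁻ⁱ` brings it to the base
      -- plane.
      have := E.glue_int_nonempty (c := 2 * i + 1 / 2) (i := -i) (j := -i) (x := 1 / 2)
        (y := -(1 / 2)) (by linarith) (by linarith) (by push_cast; ring) (by push_cast; ring) rfl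
      refine this.mono (Set.inter_subset_inter Set.subset_union_left ?_)
      refine subset_trans ?_ (Set.smul_set_mono Set.subset_union_right)
      rw [smul_smul, E.edgeTurn_even, inv_mul_cancel_right]
      exact subset_rfl
    · push_cast at h1 h2
      have := (E.glue_int_nonempty (c := 2 * i - 1 / 2) (i := -i) (j := -i) (x := -(1 / 2))
        (y := 1 / 2) (by linarith) (by linarith) (by push_cast; ring) (by push_cast; ring)
        rfl).smul_set (a := E.w)
      rw [Set.smul_set_inter] at this
      refine this.mono (Set.inter_subset_inter Set.subset_union_right ?_)
      refine subset_trans ?_ (Set.smul_set_mono Set.subset_union_left)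
      rw [smul_smul, E.edgeTurn_odd]
      exact subset_rfl

theorem smul_mem_track_iff {g : CubeGroup} (hg : g ∈ E.edgeGroup) {ξ : Cubing} :
    g • ξ ∈ E.track ↔ ξ ∈ E.track := by
  obtain ⟨s, v, rfl⟩ := exists_eq_mk ξ
  rw [smul_mk, mk_mem_track, mk_mem_track]
  simp only [mul_assoc, Subgroup.mul_mem_cancel_left _ hg]

theorem smul_mem_evenRegion_iff {g : CubeGroup} (hg : g ∈ E.evenGroup) {ξ : Cubing} :
    g • ξ ∈ E.evenRegion ↔ ξ ∈ E.evenRegion := by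
  obtain ⟨s, v, rfl⟩ := exists_eq_mk ξ
  rw [smul_mk, mk_mem_evenRegion, mk_mem_evenRegion]
  simp only [mul_assoc, Subgroup.mul_mem_cancel_left _ hg]

theorem smul_mem_oddRegion_iff {g : CubeGroup} (hg : g ∈ E.oddGroup) {ξ : Cubing} :
    g • ξ ∈ E.oddRegion ↔ ξ ∈ E.oddRegion := by
  obtain ⟨s, v, rfl⟩ := exists_eq_mk ξ
  rw [smul_mk, mk_mem_oddRegion, mk_mem_oddRegion]
  simp only [mul_assoc, Subgroup.mul_mem_cancel_left _ hg]

theorem plane_subset_track : plane p q r (1 / 2) ⊆ E.track := by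
  rintro _ ⟨v, hv, rfl⟩
  rw [Set.mem_ofPred_eq] at hv
  refine E.mk_mem_track.2 ⟨2 * 0, by rw [hv]; simp, ?_⟩
  rw [E.pos_even]
  simp

theorem track_eq : E.track = ⋃ g ∈ E.edgeGroup, g • E.trackPiece := by
  refine Set.Subset.antisymm (fun ξ hξ => ?_) (Set.iUnion₂_subset fun g hg => ?_)
  · obtain ⟨s, v, rfl⟩ := exists_eq_mk ξ
    obtain ⟨k, hk, hs⟩ := E.mk_mem_track.1 hξ
    simp only [Set.mem_iUnion]
    obtain ⟨i, rfl | rfl⟩ := HeightData.exists_eq_two_mul_or k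
    · rw [E.pos_even] at hs
      obtain ⟨v', hv', e⟩ := E.mk_mul_t_zpow (s * E.t ^ i) (-i) v
      rw [zpow_neg, mul_inv_cancel_right] at e
      refine ⟨_, hs, Cubing.mk 1 v', Or.inl ⟨v', ?_, rfl⟩, ?_⟩
      · push_cast at hk hv'
        rw [Set.mem_ofPred_eq]; linarith
      · change _ • Cubing.mk 1 v' = _
        rw [smul_mk, mul_one, e]
    · rw [E.pos_odd, ← mul_assoc] at hs
      obtain ⟨v', hv', e⟩ := E.mk_mul_t_zpow (s * E.t ^ i) (-i) v
      rw [zpow_neg, mul_inv_cancel_right] at e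
      refine ⟨_, hs, _, Or.inr ⟨Cubing.mk 1 v', ⟨v', ?_, rfl⟩, rfl⟩, ?_⟩
      · push_cast at hk hv'
        rw [Set.mem_ofPred_eq]; linarith
      · change _ • E.w • Cubing.mk 1 v' = _
        rw [smul_smul, smul_mk, inv_mul_cancel_right, mul_one, e]
  · rintro _ ⟨ξ, hξ, rfl⟩
    refine (E.smul_mem_track_iff hg).2 ?_
    rcases hξ with hξ | ⟨_, ⟨v, hv, rfl⟩, rfl⟩
    · exact E.plane_subset_track hξ
    · change E.w • Cubing.mk 1 v ∈ _
      rw [Set.mem_ofPred_eq] at hv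
      rw [smul_mk]
      refine E.mk_mem_track.2 ⟨2 * 0 - 1, by rw [hv]; norm_num, ?_⟩
      rw [E.pos_odd]
      simp

theorem isConnected_track : IsConnected E.track :=
  ⟨(E.plane_nonempty _).mono E.plane_subset_track, by
    rw [track_eq]; exact E.isPreconnected_iUnion_trackPiece⟩

theorem isPreconnected_evenRegion : IsPreconnected E.evenRegion := by
  have hsub (c : ℝ) (hc : c ∈ Set.Ioo (-(1 / 2) : ℝ) (1 / 2)) : plane p q r c ⊆
      Cubing.mk 1 '' {v | height p q r v ∈ Set.Ioo (-(1 / 2) : ℝ) (1 / 2)} :=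
    Set.image_mono fun v hv => by rw [Set.mem_ofPred_eq] at hv ⊢; rwa [hv]
  have h0 := hsub 0 (by norm_num)
  have : E.evenRegion = ⋃ g ∈ E.evenGroup,
      g • Cubing.mk 1 '' {v | height p q r v ∈ Set.Ioo (-(1 / 2) : ℝ) (1 / 2)} := by
    refine Set.Subset.antisymm (fun ξ hξ => ?_) (Set.iUnion₂_subset fun g hg => ?_)
    · obtain ⟨s, v, rfl⟩ := exists_eq_mk ξ
      obtain ⟨i, hi, hs⟩ := E.mk_mem_evenRegion.1 hξ
      simp only [Set.mem_iUnion]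
      obtain ⟨v', hv', e⟩ := E.mk_mul_t_zpow (s * E.t ^ i) (-i) v
      rw [zpow_neg, mul_inv_cancel_right] at e
      refine ⟨_, hs, Cubing.mk 1 v', ⟨v', ?_, rfl⟩, ?_⟩
      · rw [Set.mem_ofPred_eq, hv']
        convert hi using 1
        push_cast; ring
      · change _ • Cubing.mk 1 v' = _
        rw [smul_mk, mul_one, e]
    · rintro _ ⟨_, ⟨v, hv, rfl⟩, rfl⟩
      refine (E.smul_mem_evenRegion_iff hg).2 (E.mk_mem_evenRegion.2 ⟨0, ?_, by simp⟩)
      simpa using hv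
  rw [this]
  refine isPreconnected_iUnion_smul_closure (isPreconnected_image_mk 1 (convex_Ioo _ _))
    ((E.plane_nonempty 0).mono h0) ?_
  rintro x (⟨j, hj, rfl⟩ | ⟨i, ⟨hi, hi'⟩, rfl⟩)
  · exact (E.T_smul_plane_nonempty hj 0).mono (Set.inter_subset_inter h0 (Set.smul_set_mono h0))
  · have h1 : (E.m : ℝ) ≤ 2 * i := by exact_mod_cast hi
    have h2 : (2 * i : ℝ) ≤ E.M := by exact_mod_cast hi'
    exact (E.glue_int_nonempty (i := -i) (j := -i) (x := 0) (y := 0) h1 h2 (by push_cast; ring)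
      (by push_cast; ring) rfl).mono (Set.inter_subset_inter h0 (Set.smul_set_mono h0))

theorem isPreconnected_oddRegion : IsPreconnected E.oddRegion := by
  have h0 : plane p q r 1 ⊆
      Cubing.mk 1 '' {v | height p q r v ∈ Set.Ioo (1 / 2 : ℝ) (3 / 2)} :=
    Set.image_mono fun v hv => by rw [Set.mem_ofPred_eq] at hv ⊢; rw [hv]; norm_num
  have : E.oddRegion = ⋃ g ∈ E.oddGroup,
      g • Cubing.mk 1 '' {v | height p q r v ∈ Set.Ioo (1 / 2 : ℝ) (3 / 2)} := by
    refine Set.Subset.antisymm (fun ξ hξ => ?_) (Set.iUnion₂_subset fun g hg => ?_)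
    · obtain ⟨s, v, rfl⟩ := exists_eq_mk ξ
      obtain ⟨i, hi, hs⟩ := E.mk_mem_oddRegion.1 hξ
      simp only [Set.mem_iUnion]
      obtain ⟨v', hv', e⟩ := E.mk_mul_t_zpow (s * E.t ^ i) (-i) v
      rw [zpow_neg, mul_inv_cancel_right] at e
      refine ⟨_, hs, Cubing.mk 1 v', ⟨v', ?_, rfl⟩, ?_⟩
      · rw [Set.mem_ofPred_eq, hv']
        convert hi using 1
        push_cast; ring
      · change _ • Cubing.mk 1 v' = _
        rw [smul_mk, mul_one, e]
    · rintro _ ⟨_, ⟨v, hv, rfl⟩, rfl⟩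
      refine (E.smul_mem_oddRegion_iff hg).2 (E.mk_mem_oddRegion.2 ⟨0, ?_, by simp⟩)
      simpa using hv
  rw [this]
  refine isPreconnected_iUnion_smul_closure (isPreconnected_image_mk 1 (convex_Ioo _ _))
    ((E.plane_nonempty 1).mono h0) ?_
  rintro x (⟨j, hj, rfl⟩ | ⟨i, ⟨hi, hi'⟩, rfl⟩)
  · exact (E.T_smul_plane_nonempty hj 1).mono (Set.inter_subset_inter h0 (Set.smul_set_mono h0))
  · have h1 : (E.m : ℝ) ≤ 2 * i + 1 := by exact_mod_cast hi
    have h2 : (2 * i + 1 : ℝ) ≤ E.M := by exact_mod_cast hi'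
    exact (E.glue_int_nonempty (i := -i) (j := -i - 1) (x := 1) (y := 1) h1 h2
      (by push_cast; ring) (by push_cast; ring) rfl).mono
      (Set.inter_subset_inter h0 (Set.smul_set_mono h0))

/-! ### Components -/

theorem track_subset_pattern : E.track ⊆ pattern p q r := fun ξ hξ => by
  obtain ⟨s, v, rfl⟩ := exists_eq_mk ξ
  obtain ⟨k, hk, -⟩ := E.mk_mem_track.1 hξ
  exact E.mk_mem_pattern.2 ⟨k, hk⟩

theorem track_subset_region : E.track ⊆ region p q r (Set.Ioo 0 1) E.trackLabel := fun ξ hξ => by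
  obtain ⟨s, v, rfl⟩ := exists_eq_mk ξ
  obtain ⟨k, hk, hs⟩ := E.mk_mem_track.1 hξ
  exact E.edgeLabel_track.mk_mem_Ioo.2 ⟨k, by rw [hk]; norm_num, hs⟩

theorem connectedComponentIn_pattern {ξ : Cubing} (hξ : ξ ∈ E.track) :
    connectedComponentIn (pattern p q r) ξ = E.track := by
  refine connectedComponentIn_eq_of_separated E.isConnected_track.isPreconnected
    E.track_subset_pattern E.edgeLabel_track.isOpen E.edgeLabel_track.not.isOpen
    E.track_subset_region ?_ E.edgeLabel_track.disjoint hξ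
  rintro η ⟨hη, hη'⟩
  obtain ⟨s, v, rfl⟩ := exists_eq_mk η
  obtain ⟨k, hk⟩ := E.mk_mem_pattern.1 hη
  exact E.edgeLabel_track.not.mk_mem_Ioo.2
    ⟨k, by rw [hk]; norm_num, fun hs => hη' (E.mk_mem_track.2 ⟨k, hk, hs⟩)⟩

theorem connectedComponentIn_compl {Ψ : CubeGroup → ℤ → Prop} (hΨ : E.VertexLabel Ψ)
    (hconn : IsPreconnected (region p q r (Set.Ioo (-(1 / 2)) (1 / 2)) Ψ)) {ξ : Cubing}
    (hξ : ξ ∈ region p q r (Set.Ioo (-(1 / 2)) (1 / 2)) Ψ) :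
    connectedComponentIn (pattern p q r)ᶜ ξ = region p q r (Set.Ioo (-(1 / 2)) (1 / 2)) Ψ := by
  refine connectedComponentIn_eq_of_separated hconn ?_ hΨ.isOpen hΨ.not.isOpen subset_rfl ?_
    hΨ.disjoint hξ
  · intro η hη
    obtain ⟨s, v, rfl⟩ := exists_eq_mk η
    obtain ⟨k, hk, -⟩ := hΨ.mk_mem.1 hη
    exact E.mk_notMem_pattern.2 ⟨k, hk⟩
  · rintro η ⟨hη, hη'⟩
    obtain ⟨s, v, rfl⟩ := exists_eq_mk η
    obtain ⟨k, hk⟩ := E.mk_notMem_pattern.1 hη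
    exact hΨ.not.mk_mem.2 ⟨k, hk, fun hs => hη' (hΨ.mk_mem.2 ⟨k, hk, hs⟩)⟩

theorem connectedComponentIn_evenRegion {ξ : Cubing} (hξ : ξ ∈ E.evenRegion) :
    connectedComponentIn (pattern p q r)ᶜ ξ = E.evenRegion :=
  E.connectedComponentIn_compl E.vertexLabel_even E.isPreconnected_evenRegion hξ

theorem connectedComponentIn_oddRegion {ξ : Cubing} (hξ : ξ ∈ E.oddRegion) :
    connectedComponentIn (pattern p q r)ᶜ ξ = E.oddRegion :=
  E.connectedComponentIn_compl E.vertexLabel_odd E.isPreconnected_oddRegion hξ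

theorem isComponentOf_track : IsComponentOf (pattern p q r) E.track := by
  obtain ⟨ξ, hξ⟩ := E.isConnected_track.nonempty
  exact ⟨ξ, E.track_subset_pattern hξ, (E.connectedComponentIn_pattern hξ).symm⟩

/-- Plane `k` of copy `s` lies in the translate of the base track by `s * pos k`. The pattern is
invariant, so this translate is the component. -/
theorem exists_eq_smul_track {t' : Set Cubing} (h : IsComponentOf (pattern p q r) t') :
    ∃ g : CubeGroup, t' = g • E.track := by
  obtain ⟨ξ, hξ, rfl⟩ := h
  obtain ⟨s, v, rfl⟩ := exists_eq_mk ξ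
  obtain ⟨k, hk⟩ := E.mk_mem_pattern.1 hξ
  have h0 : Cubing.mk (E.pos k)⁻¹ v ∈ E.track := E.mk_mem_track.2 ⟨k, hk, by simp⟩
  refine ⟨s * E.pos k, ?_⟩
  have := (Homeomorph.smul (s * E.pos k)).image_connectedComponentIn (E.track_subset_pattern h0)
  rw [E.connectedComponentIn_pattern h0] at this
  refine Eq.trans ?_ this.symm
  have h1 : Homeomorph.smul (s * E.pos k) '' pattern p q r = pattern p q r :=
    E.smul_pattern (s * E.pos k)
  rw [h1, Homeomorph.smul_apply, smul_mk, mul_inv_cancel_right]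

/-! ### Stabilizers -/

/-- A single test point suffices: an element `g` that preserves `W` sends the point of copy `1` to
the point of copy `g`, whose membership in `W` reads off whether `g` lies in `H`. -/
theorem stabilizer_eq {H : Subgroup CubeGroup} {W : Set Cubing}
    (hH : ∀ g ∈ H, ∀ ξ, g • ξ ∈ W ↔ ξ ∈ W) {v : Fin 3 → ℝ}
    (hv : ∀ g, Cubing.mk g v ∈ W ↔ g ∈ H) : MulAction.stabilizer CubeGroup W = H := by
  ext g
  rw [MulAction.mem_stabilizer_iff]
  constructor
  · intro hg
    have h1 : Cubing.mk 1 v ∈ W := (hv 1).2 (one_mem H)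
    rw [← hv, ← mul_one g, ← smul_mk, ← hg]
    exact Set.smul_mem_smul_set h1
  · intro hg
    ext ξ
    rw [Set.mem_smul_set_iff_inv_smul_mem, hH _ (inv_mem hg)]

theorem stabilizer_track : MulAction.stabilizer CubeGroup E.track = E.edgeGroup := by
  obtain ⟨v, hv⟩ := E.exists_height_eq (1 / 2)
  refine stabilizer_eq (fun g hg ξ => E.smul_mem_track_iff hg) (v := v) fun g => ?_
  rw [mk_mem_track, hv]
  constructor
  · rintro ⟨k, hk, hg⟩
    have : (k : ℝ) = 0 := by linarith
    rw [Int.cast_eq_zero.1 this, ← mul_zero 2, E.pos_even] at hg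
    simpa using hg
  · intro hg
    exact ⟨2 * 0, by simp, by rw [E.pos_even]; simpa using hg⟩

theorem int_eq_zero_of_mem_Ioo {i : ℤ} (h : (-(2 * i) : ℝ) ∈ Set.Ioo (-(1 / 2) : ℝ) (1 / 2)) :
    i = 0 := by
  rw [Set.mem_Ioo] at h
  have h1 : (i : ℝ) < 1 := by linarith
  have h2 : (-1 : ℝ) < i := by linarith
  have h1' : i < 1 := by exact_mod_cast h1
  have h2' : -1 < i := by exact_mod_cast h2
  omega

theorem stabilizer_evenRegion : MulAction.stabilizer CubeGroup E.evenRegion = E.evenGroup := by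
  obtain ⟨v, hv⟩ := E.exists_height_eq 0
  refine stabilizer_eq (fun g hg ξ => E.smul_mem_evenRegion_iff hg) (v := v) fun g => ?_
  rw [mk_mem_evenRegion, hv]
  constructor
  · rintro ⟨i, hi, hg⟩
    rw [zero_sub] at hi
    rw [int_eq_zero_of_mem_Ioo hi] at hg
    simpa using hg
  · intro hg
    exact ⟨0, by norm_num, by simpa using hg⟩

theorem stabilizer_oddRegion : MulAction.stabilizer CubeGroup E.oddRegion = E.oddGroup := by
  obtain ⟨v, hv⟩ := E.exists_height_eq 1
  refine stabilizer_eq (fun g hg ξ => E.smul_mem_oddRegion_iff hg) (v := v) fun g => ?_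
  rw [mk_mem_oddRegion, hv]
  constructor
  · rintro ⟨i, hi, hg⟩
    have : (-(2 * i) : ℝ) ∈ Set.Ioo (-(1 / 2) : ℝ) (1 / 2) := by
      rw [Set.mem_Ioo] at hi ⊢
      constructor <;> linarith
    rw [int_eq_zero_of_mem_Ioo this] at hg
    simpa using hg
  · intro hg
    exact ⟨0, by norm_num, by simpa using hg⟩

/-! ### The adjacent regions -/

theorem evenRegion_ne_oddRegion : E.evenRegion ≠ E.oddRegion := by
  intro h
  obtain ⟨v, hv⟩ := E.exists_height_eq 0
  have h0 : Cubing.mk 1 v ∈ E.evenRegion := E.mk_mem_evenRegion.2 ⟨0, by rw [hv]; norm_num, by simp⟩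
  rw [h, mk_mem_oddRegion, hv] at h0
  obtain ⟨i, hi, -⟩ := h0
  rw [Set.mem_Ioo] at hi
  have h1 : (i : ℝ) < 0 := by linarith
  have h2 : (-1 : ℝ) < i := by linarith
  have h1' : i < 0 := by exact_mod_cast h1
  have h2' : -1 < i := by exact_mod_cast h2
  omega

theorem mem_closure_of_height (E : CubeHeight p q r) {s : CubeGroup} {v : Fin 3 → ℝ}
    {W : Set Cubing} {a b : ℝ} (hab : a < b) (hv : height p q r v ∈ Set.Icc a b)
    (hW : ∀ v', height p q r v' ∈ Set.Ioo a b → Cubing.mk s v' ∈ W) :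
    Cubing.mk s v ∈ closure W := by
  -- A line in the direction `τ`, parametrized by height since the height form is 1 at `τ`.
  let f : ℝ → Cubing := fun x =>
    Cubing.mk s (v + fun i => (x - height p q r v) * (E.τ.toAdd i : ℝ))
  have hf : Continuous f := (continuous_mk s).comp (by fun_prop)
  have hf0 : f (height p q r v) = Cubing.mk s v := by
    simp only [f, sub_self, zero_mul]
    congr 1
    exact add_zero v
  rw [← hf0]
  refine closure_mono (s := f '' Set.Ioo a b) ?_ (image_closure_subset_closure_image hf
    ⟨_, by rwa [closure_Ioo hab.ne], rfl⟩)
  rintro _ ⟨x, hx, rfl⟩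
  refine hW _ ?_
  have h : (p * E.τ.toAdd 0 + q * E.τ.toAdd 1 + r * E.τ.toAdd 2 : ℝ) = 1 := by
    exact_mod_cast E.χ_τ_eq
  convert hx using 1
  rw [height_add]
  simp only [height]
  linear_combination (x - (p * v 0 + q * v 1 + r * v 2)) * h

theorem track_subset_closure_evenRegion : E.track ⊆ closure E.evenRegion := by
  intro ξ hξ
  obtain ⟨s, v, rfl⟩ := exists_eq_mk ξ
  obtain ⟨k, hk, hs⟩ := E.mk_mem_track.1 hξ
  obtain ⟨i, hi⟩ := HeightData.exists_eq_two_mul_or k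
  have hmem : s * E.t ^ i ∈ E.evenGroup := E.pos_mem_even (by
    rcases hi with rfl | rfl
    exacts [Or.inl hs, Or.inr hs])
  refine E.mem_closure_of_height (a := 2 * i - 1 / 2) (b := 2 * i + 1 / 2) (by linarith) ?_
    fun v' hv' => E.mk_mem_evenRegion.2 ⟨i, ?_, hmem⟩
  · rcases hi with rfl | rfl <;> push_cast at hk <;> constructor <;> linarith
  · rw [Set.mem_Ioo] at hv' ⊢
    constructor <;> linarith

theorem track_subset_closure_oddRegion : E.track ⊆ closure E.oddRegion := by
  intro ξ hξ
  obtain ⟨s, v, rfl⟩ := exists_eq_mk ξ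
  obtain ⟨k, hk, hs⟩ := E.mk_mem_track.1 hξ
  obtain ⟨i, hi⟩ : ∃ i, k = 2 * i ∨ k = 2 * i + 1 := Int.even_or_odd' k
  have hmem : s * E.t ^ i ∈ E.oddGroup := E.pos_mem_odd (by
    rcases hi with rfl | rfl
    exacts [Or.inl hs, Or.inr hs])
  refine E.mem_closure_of_height (a := 2 * i + 1 / 2) (b := 2 * i + 3 / 2) (by linarith) ?_
    fun v' hv' => E.mk_mem_oddRegion.2 ⟨i, ?_, hmem⟩
  · rcases hi with rfl | rfl <;> push_cast at hk <;> constructor <;> linarith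
  · rw [Set.mem_Ioo] at hv' ⊢
    constructor <;> linarith

theorem region_diff_pattern_subset {ξ : Cubing}
    (hξ : ξ ∈ region p q r (Set.Ioo 0 1) E.trackLabel) (hP : ξ ∉ pattern p q r) :
    ξ ∈ E.evenRegion ∨ ξ ∈ E.oddRegion := by
  obtain ⟨s, v, rfl⟩ := exists_eq_mk ξ
  obtain ⟨k, hk, hs⟩ := E.edgeLabel_track.mk_mem_Ioo.1 hξ
  have hne : height p q r v - k ≠ 1 / 2 := fun h => hP (E.mk_mem_pattern.2 ⟨k, h⟩)
  rw [Set.mem_Ioo] at hk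
  obtain ⟨i, rfl | rfl⟩ : ∃ i, k = 2 * i ∨ k = 2 * i + 1 := Int.even_or_odd' k <;>
    push_cast at hk hne <;> rcases hne.lt_or_gt with h | h
  · exact Or.inl (E.mk_mem_evenRegion.2
      ⟨i, ⟨by linarith, by linarith⟩, E.pos_mem_even (Or.inl hs)⟩)
  · exact Or.inr (E.mk_mem_oddRegion.2
      ⟨i, ⟨by linarith, by linarith⟩, E.pos_mem_odd (Or.inl hs)⟩)
  · exact Or.inr (E.mk_mem_oddRegion.2
      ⟨i, ⟨by linarith, by linarith⟩, E.pos_mem_odd (Or.inr hs)⟩)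
  · refine Or.inl (E.mk_mem_evenRegion.2
      ⟨i + 1, ⟨by push_cast; linarith, by push_cast; linarith⟩, E.pos_mem_even (Or.inr ?_)⟩)
    rwa [show 2 * (i + 1) - 1 = 2 * i + 1 by ring]

/-- A component with the track in its closure meets the open neighbourhood of the track formed by
heights within `1/2` of its planes. Off the pattern, this neighbourhood lies in the two base
regions. -/
theorem adjacent_components :
    {W | IsComponentOf (pattern p q r)ᶜ W ∧ E.track ⊆ closure W} = {E.evenRegion, E.oddRegion} := by
  ext W
  simp only [Set.mem_ofPred_eq, Set.mem_insert_iff, Set.mem_singleton_iff]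
  constructor
  · rintro ⟨⟨ξ, hξ, rfl⟩, h⟩
    obtain ⟨η, hη⟩ := E.isConnected_track.nonempty
    obtain ⟨ζ, hζ, hζ'⟩ := mem_closure_iff.1 (h hη) _ E.edgeLabel_track.isOpen
      (E.track_subset_region hη)
    rw [connectedComponentIn_eq hζ']
    rcases E.region_diff_pattern_subset hζ (connectedComponentIn_subset _ _ hζ') with h1 | h1
    · exact Or.inl (E.connectedComponentIn_evenRegion h1)
    · exact Or.inr (E.connectedComponentIn_oddRegion h1)
  · have sub {ξ : Cubing} {W : Set Cubing} (hξ : ξ ∈ W)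
        (hW : connectedComponentIn (pattern p q r)ᶜ ξ = W) : IsComponentOf (pattern p q r)ᶜ W :=
      ⟨ξ, by rw [← connectedComponentIn_nonempty_iff, hW]; exact ⟨ξ, hξ⟩, hW.symm⟩
    have hne := E.isConnected_track.nonempty
    rintro (rfl | rfl)
    · obtain ⟨ξ, hξ⟩ := closure_nonempty_iff.1 (hne.mono E.track_subset_closure_evenRegion)
      exact ⟨sub hξ (E.connectedComponentIn_evenRegion hξ), E.track_subset_closure_evenRegion⟩
    · obtain ⟨ξ, hξ⟩ := closure_nonempty_iff.1 (hne.mono E.track_subset_closure_oddRegion)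
      exact ⟨sub hξ (E.connectedComponentIn_oddRegion hξ), E.track_subset_closure_oddRegion⟩

/-! ### The track -/

theorem half_ne_int_sub_int (a b : ℤ) : (a : ℝ) - b ≠ 1 / 2 := by
  intro h
  have : ((2 * (a - b) : ℤ) : ℝ) = (1 : ℤ) := by push_cast; linarith
  have := Int.cast_injective this
  omega

theorem isTrack_track : IsTrack E.track := by
  classical
  refine ⟨E.isConnected_track, fun s n h => ?_, fun s n i j _ => ?_⟩
  · obtain ⟨k, hk, -⟩ := E.mk_mem_track.1 h
    refine half_ne_int_sub_int (p * n 0 + q * n 1 + r * n 2) k ?_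
    push_cast
    exact hk
  · set α : ℤ := ![p, q, r] i
    set β : ℤ := ![p, q, r] j
    set N : ℤ := p * n 0 + q * n 1 + r * n 2
    have hmem (u w : ℝ) : squarePt s n i j u w ∈ E.track ↔
        ∃ k : ℤ, (N + α * u + β * w : ℝ) - k = 1 / 2 ∧ s * E.pos k ∈ E.edgeGroup := by
      have hN : height p q r (fun k => (n k : ℝ)) = N := by simp [height, N]
      rw [squarePt, mk_mem_track, height_add, height_add, height_single, height_single, hN]
    -- On such a square the height is a constant integer, so the track misses it. The direction `(1,
    -- 0)` is then an arbitrary nonzero choice.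
    by_cases h0 : α = 0 ∧ β = 0
    · refine ⟨1, 0, ∅, by simp, fun u _ w _ => ?_⟩
      rw [hmem, h0.1, h0.2]
      simp only [Finset.notMem_empty, iff_false, not_exists, not_and]
      intro k hk
      exact absurd (by simpa using hk) (half_ne_int_sub_int N k)
    · let K : ℤ := |α| + |β|
      -- Heights on the square stay within `K` of the corner height `N`; the extra `-1` accommodates
      -- the offset `1/2` of the planes.
      refine ⟨α, β, ((Finset.Icc (N - K - 1) (N + K)).filter fun k =>
        s * E.pos k ∈ E.edgeGroup).image fun k : ℤ => (k : ℝ) + 1 / 2 - N, ?_,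
        fun u hu w hw => ?_⟩
      · intro h
        rw [Prod.mk.injEq, Int.cast_eq_zero, Int.cast_eq_zero] at h
        exact h0 h
      · rw [hmem]
        simp only [Finset.mem_image, Finset.mem_filter, Finset.mem_Icc]
        constructor
        · rintro ⟨k, hk, hs⟩
          have bound (α : ℤ) {u : ℝ} (hu : u ∈ Set.Icc (0 : ℝ) 1) : |α * u| ≤ |(α : ℝ)| := by
            rw [abs_mul, abs_of_nonneg hu.1]
            exact mul_le_of_le_one_right (abs_nonneg _) hu.2
          have h1 := abs_le.1 (bound α hu)
          have h2 := abs_le.1 (bound β hw)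
          have h3 : ((N - K - 1 : ℤ) : ℝ) ≤ k := by push_cast [K]; linarith
          have h4 : (k : ℝ) ≤ (N + K : ℤ) := by push_cast [K]; linarith
          exact ⟨k, ⟨⟨by exact_mod_cast h3, by exact_mod_cast h4⟩, hs⟩, by linarith⟩
        · rintro ⟨k, ⟨-, hs⟩, hk⟩
          exact ⟨k, by linarith, hs⟩

end CubeHeight

theorem mainTheorem6 (p q r : ℤ) (hpqr : Int.gcd p (Int.gcd q r) = 1) :
    ∃ t : Set Cubing,
      -- `t` is a track given by planes `x + y + z = c`, and all such tracks are translates of it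
      Cubing.IsTrack t ∧
      IsComponentOf (Cubing.pattern p q r) t ∧
      Cubing.plane p q r (1 / 2) ⊆ t ∧
      (∀ t' : Set Cubing, IsComponentOf (Cubing.pattern p q r) t' →
        ∃ g : CubeGroup, t' = g • t) ∧
      -- the stabilizer of `t` is `ℤ² * ℤ² * F` with `F` free of rank `|p| + |q| + |r| - 1`
      Nonempty (MulAction.stabilizer CubeGroup t ≃*
        TwoTorusFreeProduct (p.natAbs + q.natAbs + r.natAbs - 1)) ∧
      -- `S` splits over it, the factors being the stabilizers of the two regions adjacent to `t`
      ∃ U V : Set Cubing, U ≠ V ∧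
        {W | IsComponentOf (Cubing.pattern p q r)ᶜ W ∧ t ⊆ closure W} = {U, V} ∧
        SplitsAsAmalgam (MulAction.stabilizer CubeGroup U) (MulAction.stabilizer CubeGroup V)
          (MulAction.stabilizer CubeGroup t) := by
  obtain ⟨E⟩ := CubeHeight.nonempty hpqr
  refine ⟨E.track, E.isTrack_track, E.isComponentOf_track, E.plane_subset_track,
    fun t' => E.exists_eq_smul_track, ?_, E.evenRegion, E.oddRegion, E.evenRegion_ne_oddRegion,
    E.adjacent_components, ?_⟩
  · rw [E.stabilizer_track]
    exact E.nonempty_edgeGroup_equiv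
  · rw [E.stabilizer_track, E.stabilizer_evenRegion, E.stabilizer_oddRegion]
    exact E.splitsAsAmalgam
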